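/- **Theorem (Maximal inequality under parameter-dependent IS ratio bound).** Consider a contextual bandit with contexts $W_i\in\mathcal W=[0,1]^d$, actions $A_i\in[K]$ and rewards $Y_i\in\{0,1\}$, and write $O_i=(W_i,A_i,Y_i)$, $F_i=\sigma(O_1,\dots,O_i)$. Each $W_i$ is independent of $F_{i-1}$, with a law that does not depend on $i$; given $F_{i-1}$ and $W_i$, the action satisfies $A_i\sim g_i(\cdot\mid W_i)$, where the design $g_i$ (a probability vector $g_i(\cdot\mid w)$ on $[K]$ for every $w$) is $F_{i-1}$-measurable; given $F_{i-1},W_i,A_i$, the law of $Y_i$ depends only on $(A_i,W_i)$ and not on $i$. Let $\mathcal F$ be a class of measurable functions $f:[K]\times\mathcal W\to[0,1]$, $(a,w)\mapsto f(a|w)$. For $f\in\mathcal F$ put $$\ell_i(f)(w,a,y)=\frac{f(a|w)}{g_i(a|w)}(1-y),\qquad V_i(f)=E_W\Big[\sum_{a\in[K]}\frac{f(a|W)}{g_i(a|W)}\Big],\qquad \bar V_n(f)=\frac1n\sum_{i=1}^nV_i(f),$$ where $E_W$ integrates over a context $W$ only, with $g_i$ held fixed at its realised value, and $$(P-P_n)\ell_{1:n}(f)=\frac1n\sum_{i=1}^n\Big(E\big[\ell_i(f)(O_i)\mid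 F_{i-1}\big]-\ell_i(f)(O_i)\Big),$$ the conditional expectations being computed, for all $f$, with one regular conditional distribution of $O_i$ given $O_1,\dots,O_{i-1}$. Let $N_{[\,]}(\eta,\mathcal F,L_\infty(P))\in\mathbb N\cup\{\infty\}$ be the minimal number of brackets $[l,u]=\{f: l\le f\le u \text{ pointwise}\}$, with $l,u$ measurable and $\|u-l\|_\infty\le\eta$ (essential supremum with respect to $\mathrm{Unif}([K])\otimes\mathrm{law}(W_1)$), needed to cover $\mathcal F$. Let $n\ge1$ and suppose that there is $\delta>0$ such that, almost surely, $g_i(a|w)\ge\delta$ for all $i\in[n]$, $a\in[K]$, $w\in\mathcal W$. Then, for all $x>0$, $v>0$ and $\epsilon\in[0,1]$, $$P\left[\sup_{f\in\mathcal F}\mathbf 1\{\bar V_n(f)\le v\}\,(P-P_n)\ell_{1:n}(f)\ \ge\ H_n(v,\delta,\epsilon)+37\sqrt{\frac{vx}{n}}+\frac{3x}{\delta n}\right]\le 2e^{-x},$$ where $$H_n(v,\delta,\epsilon)=\sqrt{v\epsilon}+127\sqrt{\frac vn}\int_{\sqrt{\epsilon/2}}^1\sqrt{\log\big(1+N_{[\,]}(u^2,\mathcal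 F,L_\infty(P))\big)}\,du+\frac{3}{\delta n}\log\big(1+N_{[\,]}(1,\mathcal F,L_\infty(P))\big)\in[0,\infty].$$ If the event is not measurable, $P$ denotes the outer probability. -/

import Mathlib

open MeasureTheory ProbabilityTheory
open scoped ENNReal

noncomputable section

/-! ### The contextual bandit

Time is indexed from `0`: the time point called `i + 1` in the usual one-based numbering has index
`i` here, so that the observations made strictly before time index `i` are `O 0, …, O (i - 1)`. -/

/-- The context space `𝒲 = [0,1]^d`. -/
abbrev Context (d : ℕ) : Type := Fin d → unitInterval

/-- An observation `o = (w, a, y)`: a context, an action in `[K]`, a reward in `{0, 1}`. -/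
abbrev Obs (d K : ℕ) : Type := Context d × Fin K × Fin 2

/-- A (random, history-dependent) sequence of designs: `g i h (a, w)` is `g_i(a | w)` when the
observations made before time index `i` are `h`. -/
abbrev Designs (d K : ℕ) : Type := (i : ℕ) → (Fin i → Obs d K) → Fin K × Context d → ℝ

section Model

variable {Ω : Type*} {d K : ℕ}

/-- The history available before time index `i`. -/
def history (O : ℕ → Ω → Obs d K) (i : ℕ) (ω : Ω) : Fin i → Obs d K := fun j => O j ω

/-- The σ-algebra generated by the observations made before time index `i`. -/
abbrev past (O : ℕ → Ω → Obs d K) (i : ℕ) : MeasurableSpace Ω :=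
  MeasurableSpace.comap (history O i) inferInstance

/-- `O` is a contextual bandit run with designs `g`, where `g i` is a measurable function of
the history before time `i` and of `(a, w)` (that is, `g i` is predictable). At each time the context
is drawn from a fixed law independently of the past; given the past and the context, the action
is drawn from the design; given the past, the context and the action, the reward is drawn from a
fixed law that depends on the context and the action only. -/
structure IsContextualBandit [MeasurableSpace Ω] (μ : Measure Ω) (O : ℕ → Ω → Obs d K)
    (g : Designs d K) : Prop where
  measurable_obs : ∀ i, Measurable (O i)
  measurable_design : ∀ i, Measurable fun p : (Fin i → Obs d K) × (Fin K × Context d) => g i p.1 p.2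
  design_nonneg : ∀ i h a w, 0 ≤ g i h (a, w)
  design_sum : ∀ i h w, ∑ a, g i h (a, w) = 1
  context_law : ∀ i, μ.map (fun ω => (O i ω).1) = μ.map (fun ω => (O 0 ω).1)
  context_indep : ∀ i, IndepFun (fun ω => (O i ω).1) (history O i) μ
  action_law : ∀ i a,
    μ⟦{ω | (O i ω).2.1 = a} | MeasurableSpace.comap (fun ω => (history O i ω, (O i ω).1))
        inferInstance⟧
      =ᵐ[μ] fun ω => g i (history O i ω) (a, (O i ω).1)
  reward_law : ∃ q : Fin K × Context d → ℝ, Measurable q ∧ ∀ i,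
    μ⟦{ω | (O i ω).2.2 = 1} | MeasurableSpace.comap
        (fun ω => (history O i ω, (O i ω).1, (O i ω).2.1)) inferInstance⟧
      =ᵐ[μ] fun ω => q ((O i ω).2.1, (O i ω).1)

/-- The IS-weighted loss `f(a|w) / g(a|w) * (1 - y)` of `f` under the design `γ`. -/
def isLoss (γ f : Fin K × Context d → ℝ) (o : Obs d K) : ℝ :=
  f (o.2.1, o.1) / γ (o.2.1, o.1) * (1 - ((o.2.2 : ℕ) : ℝ))

/-- The conditional expectation of `ℓ_i(f)(O_i)` given the past, computed with the regular
conditional distribution of `O_i` given the history, the predictable design being frozen at its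
realised value. Using one conditional distribution for all `f` makes suprema over uncountable
classes of functions meaningful; `condLoss_ae_eq_condExp` below is the agreement with `condExp`. -/
def condLoss [NeZero K] [MeasurableSpace Ω] (μ : Measure Ω) [IsFiniteMeasure μ]
    (O : ℕ → Ω → Obs d K) (g : Designs d K) (i : ℕ) (f : Fin K × Context d → ℝ) (ω : Ω) : ℝ :=
  ∫ o, isLoss (g i (history O i ω)) f o ∂(condDistrib (O i) (history O i) μ (history O i ω))

/-- The martingale process
`(P - P_n) ℓ_{1:n}(f) = n⁻¹ ∑_i (E[ℓ_i(f)(O_i) | past] - ℓ_i(f)(O_i))`. -/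
def isProcess [NeZero K] [MeasurableSpace Ω] (μ : Measure Ω) [IsFiniteMeasure μ]
    (O : ℕ → Ω → Obs d K) (g : Designs d K) (n : ℕ) (f : Fin K × Context d → ℝ) (ω : Ω) : ℝ :=
  (n : ℝ)⁻¹ * ∑ i ∈ Finset.range n,
    (condLoss μ O g i f ω - isLoss (g i (history O i ω)) f (O i ω))

/-- The IS ratio `V_i(f) = E_W[∑_a f(a|W) / g_i(a|W)]`: the expectation is over a context `W`,
the design being the one realised at time index `i` (so `V_i(f)` is a function of the past). -/
def isRatio [MeasurableSpace Ω] (μ : Measure Ω) (O : ℕ → Ω → Obs d K) (g : Designs d K) (i : ℕ)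
    (f : Fin K × Context d → ℝ) (ω : Ω) : ℝ :=
  ∫ w, ∑ a, f (a, w) / g i (history O i ω) (a, w) ∂(μ.map fun ω' => (O 0 ω').1)

/-- The averaged IS ratio `n⁻¹ ∑_i V_i(f)`. -/
def avgIsRatio [MeasurableSpace Ω] (μ : Measure Ω) (O : ℕ → Ω → Obs d K) (g : Designs d K) (n : ℕ)
    (f : Fin K × Context d → ℝ) (ω : Ω) : ℝ :=
  (n : ℝ)⁻¹ * ∑ i ∈ Finset.range n, isRatio μ O g i f ω

/-- The reference law of `(A, W)`: `A` uniform on `[K]`, independent of a context `W`. Its null sets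
are those of the law of `(A_i, W_i)` whenever the design is bounded below by a positive constant. -/
def refLaw [MeasurableSpace Ω] (μ : Measure Ω) (O : ℕ → Ω → Obs d K) :
    Measure (Fin K × Context d) :=
  (uniformOn (Set.univ : Set (Fin K))).prod (μ.map fun ω => (O 0 ω).1)

theorem condLoss_ae_eq_condExp [NeZero K] [MeasurableSpace Ω] {μ : Measure Ω} [IsFiniteMeasure μ]
    {O : ℕ → Ω → Obs d K} {g : Designs d K} (h : IsContextualBandit μ O g) (i : ℕ)
    {f : Fin K × Context d → ℝ} (hf : Measurable f)
    (hint : Integrable (fun ω => isLoss (g i (history O i ω)) f (O i ω)) μ) :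
    condLoss μ O g i f
      =ᵐ[μ] μ[fun ω => isLoss (g i (history O i ω)) f (O i ω) | past O i] := by
  have hX : Measurable (history O i) := measurable_pi_lambda _ fun j => h.measurable_obs j
  have hF : Measurable fun p : (Fin i → Obs d K) × Obs d K => isLoss (g i p.1) f p.2 := by
    have h1 : Measurable fun p : (Fin i → Obs d K) × Obs d K => (p.2.2.1, p.2.1) := by fun_prop
    have h2 : Measurable fun p : (Fin i → Obs d K) × Obs d K =>
        g i p.1 (p.2.2.1, p.2.1) :=
      (h.measurable_design i).comp (measurable_fst.prodMk h1)
    have h3 : Measurable fun p : (Fin i → Obs d K) × Obs d K => ((p.2.2.2 : ℕ) : ℝ) :=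
      (measurable_of_countable fun y : Fin 2 => ((y : ℕ) : ℝ)).comp
        (measurable_snd.comp (measurable_snd.comp measurable_snd))
    exact ((hf.comp h1).div h2).mul (measurable_const.sub h3)
  exact (condExp_prod_ae_eq_integral_condDistrib' hX (h.measurable_obs i).aemeasurable
    (f := fun p : (Fin i → Obs d K) × Obs d K => isLoss (g i p.1) f p.2)
    ((integrable_map_measure hF.aestronglyMeasurable
      (hX.prodMk (h.measurable_obs i)).aemeasurable).2 hint)).symm

end Model

/-! ### Bracketing numbers and the entropy term -/

/-- The bracketing number `N_{[]}(ε, F, L_p(ν))`: the least number of brackets `[l, u]` (with `l`, `u`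
measurable) such that `‖u - l‖_{L_p(ν)} ≤ ε` needed to cover `F`; it is `⊤` when no finite number of
brackets suffices. -/
def bracketingNumber {X : Type*} [MeasurableSpace X] (ε : ℝ) (F : Set (X → ℝ)) (p : ℝ≥0∞)
    (ν : Measure X) : ℕ∞ :=
  ⨅ (N : ℕ) (_ : ∃ l u : Fin N → X → ℝ,
      (∀ k, Measurable (l k) ∧ Measurable (u k) ∧ eLpNorm (u k - l k) p ν ≤ ENNReal.ofReal ε) ∧
      ∀ f ∈ F, ∃ k, ∀ x, l k x ≤ f x ∧ f x ≤ u k x), (N : ℕ∞)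

/-- `log (1 + N)` for an extended natural number `N`, with `log (1 + ⊤) = ⊤`. -/
def logOneAdd (N : ℕ∞) : ℝ≥0∞ := (ENNReal.log (1 + (N : ℝ≥0∞))).toENNReal

/-- The term `H_n(v, δ, ε)`, with values in `[0, ∞]` (it is `∞` when the entropy integral is). -/
def entropyTerm {X : Type*} [MeasurableSpace X] (F : Set (X → ℝ)) (ν : Measure X)
    (n : ℕ) (v δ ε : ℝ) : ℝ≥0∞ :=
  ENNReal.ofReal (√(v * ε))
    + ENNReal.ofReal (127 * √(v / n))
      * ∫⁻ u in Set.Icc (√(ε / 2)) 1, logOneAdd (bracketingNumber (u ^ 2) F ∞ ν) ^ (1 / 2 : ℝ)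
    + ENNReal.ofReal (3 / (δ * n)) * logOneAdd (bracketingNumber 1 F ∞ ν)

end

/-! For `y ≥ 0` one has exp(-y) ≤ 1 - y + y²/2, so a nonnegative `X` satisfies E exp(t(EX - X) -
t²E[X²]/2) ≤ 1 for all `t ≥ 0`: its lower tail is sub-Gaussian with the second moment as variance
proxy, and no linear Bernstein term appears. The process is a sum of conditional means minus losses.
For one function `h ≥ 0` the conditional bounds therefore multiply along time
(`lintegral_exp_sum_le_one`), and Chernoff gives the deviation √(2bt/n) on the event that the
averaged quadratic terms `isQuad` of `h` are at most `b` (`measure_isProcess_ge_le`).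

The second moment of the loss of `h` is at most E_W ∑ h²/g. If 0 ≤ h ≤ f and h ≤ η, this is at most
η V_i(f). The random constraint on `f` alone thus gives b = ηv for every such `h` (`avg_isQuad_le`).

Chaining must then use increments that are nonnegative and lie below `f`. Each `f` is approximated
from below by running maxima of lower bracket ends, at sup-norm radii η_j that halve at each level.
The links of level j number at most the product of the bracketing numbers so far, and the confidence
levels x + 2∑ log(1 + N_i) make the union bound cost exp(-x). The residual `f - p` at the last level
needs no concentration: its process is at most its compensator, hence at most √(2η_m v) = √(vε)
(`isProcess_le_sum_links`). Along the geometric radii the thresholds add up to the entropy integral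
(`sum_thresholds_le`, `sum_le_lintegral_entropy`).

For ε > 0 this proves the bound with probability exp(-x) and without the terms in 1/(δn). The term
3x/(δn) serves only as strictly positive slack, which absorbs the passage from ε = 0 to a small
positive ε. -/

noncomputable section

/-! ### The law of (action, context) under a fixed design -/

/-- The joint law of the action and the context when the context has law `ν` and the action is drawn
from the design `γ`. -/
def designLaw {d K : ℕ} (ν : Measure (Context d)) (γ : Fin K × Context d → ℝ) :
    Measure (Fin K × Context d) :=
  (Measure.count.prod ν).withDensity fun z => ENNReal.ofReal (γ z)

theorem lintegral_designLaw {d K : ℕ} {ν : Measure (Context d)} [SFinite ν]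
    {γ : Fin K × Context d → ℝ} (hγ : Measurable γ) {φ : Fin K × Context d → ℝ≥0∞}
    (hφ : Measurable φ) :
    ∫⁻ z, φ z ∂designLaw ν γ = ∫⁻ w, ∑ a, ENNReal.ofReal (γ (a, w)) * φ (a, w) ∂ν := by
  have hm : Measurable fun z => ENNReal.ofReal (γ z) := hγ.ennreal_ofReal
  rw [designLaw, lintegral_withDensity_eq_lintegral_mul _ hm hφ,
    lintegral_prod _ (hm.mul hφ).aemeasurable, lintegral_count, tsum_fintype,
    lintegral_finsetSum]
  · rfl
  · intro a _
    exact (hm.mul hφ).comp measurable_prodMk_left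

theorem isProbabilityMeasure_designLaw {d K : ℕ} {ν : Measure (Context d)} [IsProbabilityMeasure ν]
    {γ : Fin K × Context d → ℝ} (hγ : Measurable γ) (h0 : ∀ a w, 0 ≤ γ (a, w))
    (h1 : ∀ w, ∑ a, γ (a, w) = 1) : IsProbabilityMeasure (designLaw ν γ) := by
  constructor
  rw [← lintegral_one, lintegral_designLaw hγ measurable_const]
  simp only [mul_one]
  calc _ = ∫⁻ w, 1 ∂ν := by
        refine lintegral_congr fun w => ?_
        rw [← ENNReal.ofReal_sum_of_nonneg fun a _ => h0 a w, h1, ENNReal.ofReal_one]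
    _ = 1 := by simp

/-! ### Conditional law of (action, context) given the history -/

section Bandit

variable {Ω : Type*} [MeasurableSpace Ω] {μ : Measure Ω} {d K : ℕ} {O : ℕ → Ω → Obs d K}
  {g : Designs d K}

theorem IsContextualBandit.measurable_history (h : IsContextualBandit μ O g) (i : ℕ) :
    Measurable (history O i) :=
  measurable_pi_lambda _ fun j => h.measurable_obs j

theorem IsContextualBandit.measurable_design_apply (h : IsContextualBandit μ O g) (i : ℕ)
    (H : Fin i → Obs d K) : Measurable (g i H) :=
  (h.measurable_design i).comp measurable_prodMk_left

theorem IsContextualBandit.map_history_context [IsProbabilityMeasure μ]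
    (h : IsContextualBandit μ O g) (i : ℕ) :
    μ.map (fun ω => (history O i ω, (O i ω).1))
      = (μ.map (history O i)).prod (μ.map fun ω => (O 0 ω).1) := by
  have hw : Measurable fun ω => (O i ω).1 := measurable_fst.comp (h.measurable_obs i)
  rw [← h.context_law i]
  exact (h.context_indep i).symm.map_prod_eq_prod_map_map (h.measurable_history i).aemeasurable
    hw.aemeasurable

/-- Testing `action_law` on the sets of the conditioning σ-algebra turns an almost sure statement
about conditional probabilities into an identity of measures, against which arbitrary functions can
be integrated. -/
theorem IsContextualBandit.map_restrict_action [IsProbabilityMeasure μ]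
    (h : IsContextualBandit μ O g) (i : ℕ) (a : Fin K) :
    (μ.restrict {ω | (O i ω).2.1 = a}).map (fun ω => (history O i ω, (O i ω).1))
      = ((μ.map (history O i)).prod (μ.map fun ω => (O 0 ω).1)).withDensity
          fun p => ENNReal.ofReal (g i p.1 (a, p.2)) := by
  have hw : Measurable fun ω => (O i ω).1 := measurable_fst.comp (h.measurable_obs i)
  have ha : Measurable fun ω => (O i ω).2.1 :=
    measurable_fst.comp (measurable_snd.comp (h.measurable_obs i))
  have hp : Measurable fun ω => (history O i ω, (O i ω).1) := (h.measurable_history i).prodMk hw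
  have hA : MeasurableSet {ω | (O i ω).2.1 = a} := ha (measurableSet_singleton a)
  have hd : Measurable fun p : (Fin i → Obs d K) × Context d => g i p.1 (a, p.2) :=
    (h.measurable_design i).comp
      (measurable_fst.prodMk (measurable_const.prodMk measurable_snd))
  rw [← h.map_history_context i]
  ext S hS
  rw [Measure.map_apply hp hS, Measure.restrict_apply (hp hS), withDensity_apply _ hS,
    setLIntegral_map hS hd.ennreal_ofReal hp]
  have hle : MeasurableSpace.comap (fun ω => (history O i ω, (O i ω).1)) inferInstance
      ≤ (inferInstance : MeasurableSpace Ω) := hp.comap_le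
  have hint : Integrable (fun ω => g i (history O i ω) (a, (O i ω).1)) μ :=
    (integrable_condExp (m := MeasurableSpace.comap (fun ω => (history O i ω, (O i ω).1))
      inferInstance)).congr (h.action_law i a)
  have key := setIntegral_condExp (μ := μ) hle
    (f := {ω | (O i ω).2.1 = a}.indicator fun _ => (1 : ℝ))
    ((integrable_const 1).indicator hA) (s := (fun ω => (history O i ω, (O i ω).1)) ⁻¹' S)
    ⟨S, hS, rfl⟩
  rw [setIntegral_congr_ae (hp hS) ((h.action_law i a).mono fun _ hx _ => hx),
    integral_indicator hA, Measure.restrict_restrict hA, setIntegral_const, smul_eq_mul,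
    mul_one] at key
  rw [← ofReal_integral_eq_lintegral_ofReal hint.integrableOn
    (Filter.Eventually.of_forall fun ω => h.design_nonneg _ _ _ _), key, Set.inter_comm,
    ofReal_measureReal]

/-- A regular conditional distribution is determined almost everywhere by the joint law it
disintegrates, and the joint law is computed by splitting over the value of the action. Moments
under `condDistrib` thereby become explicit integrals against the realised design. -/
theorem IsContextualBandit.condDistrib_action_context [NeZero K] [IsProbabilityMeasure μ]
    (h : IsContextualBandit μ O g) (i : ℕ) :
    ∀ᵐ ω ∂μ, (condDistrib (O i) (history O i) μ (history O i ω)).map (fun o => (o.2.1, o.1))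
      = designLaw (μ.map fun ω => (O 0 ω).1) (g i (history O i ω)) := by
  have hH := h.measurable_history i
  have hOi := h.measurable_obs i
  have hw : Measurable fun ω => (O i ω).1 := measurable_fst.comp hOi
  have hpr : Measurable fun o : Obs d K => (o.2.1, o.1) := by fun_prop
  have hw0 : Measurable fun ω => (O 0 ω).1 := measurable_fst.comp (h.measurable_obs 0)
  set ν := μ.map fun ω => (O 0 ω).1 with hν
  have : IsProbabilityMeasure ν := Measure.isProbabilityMeasure_map hw0.aemeasurable
  have hgm : Measurable (Function.uncurry fun (H : Fin i → Obs d K) (z : Fin K × Context d) =>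
      ENNReal.ofReal (g i H z)) := (h.measurable_design i).ennreal_ofReal
  let η : Kernel (Fin i → Obs d K) (Fin K × Context d) :=
    Kernel.withDensity (Kernel.const _ (Measure.count.prod ν)) fun H z => ENNReal.ofReal (g i H z)
  have hη : ∀ H, η H = designLaw ν (g i H) := fun H => by
    rw [Kernel.withDensity_apply _ hgm, Kernel.const_apply, designLaw]
  have : IsMarkovKernel η := ⟨fun H => by
    rw [hη]
    exact isProbabilityMeasure_designLaw (h.measurable_design_apply i H) (h.design_nonneg i H)
      (h.design_sum i H)⟩
  have key : condDistrib (fun ω => ((O i ω).2.1, (O i ω).1)) (history O i) μ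
      =ᵐ[μ.map (history O i)] η := by
    refine condDistrib_ae_eq_of_measure_eq_compProd _ (hpr.comp hOi).aemeasurable ?_
    refine Measure.ext_of_lintegral _ fun F hF => ?_
    rw [Measure.lintegral_compProd hF, lintegral_map hF (hH.prodMk (hpr.comp hOi))]
    have hsec : ∀ a, Measurable fun p : (Fin i → Obs d K) × Context d => F (p.1, (a, p.2)) :=
      fun a => hF.comp (measurable_fst.prodMk (measurable_const.prodMk measurable_snd))
    have hd : ∀ a, Measurable fun p : (Fin i → Obs d K) × Context d =>
        ENNReal.ofReal (g i p.1 (a, p.2)) := fun a =>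
      hgm.comp (measurable_fst.prodMk (measurable_const.prodMk measurable_snd))
    have hA : ∀ a, MeasurableSet {ω | (O i ω).2.1 = a} := fun a =>
      (measurable_fst.comp (measurable_snd.comp hOi)) (measurableSet_singleton a)
    calc ∫⁻ ω, F (history O i ω, ((O i ω).2.1, (O i ω).1)) ∂μ
        = ∑ a, ∫⁻ ω in {ω | (O i ω).2.1 = a}, F (history O i ω, (a, (O i ω).1)) ∂μ := by
          have : ∀ ω, F (history O i ω, ((O i ω).2.1, (O i ω).1))
              = ∑ a, {ω | (O i ω).2.1 = a}.indicator
                  (fun ω => F (history O i ω, (a, (O i ω).1))) ω := fun ω => by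
            rw [Finset.sum_eq_single (O i ω).2.1]
            · simp
            · intro b _ hb
              exact Set.indicator_of_notMem (fun hc => hb hc.symm) _
            · simp
          rw [lintegral_congr this, lintegral_finsetSum]
          · exact Finset.sum_congr rfl fun a _ => lintegral_indicator (hA a) _
          · exact fun a _ => ((hsec a).comp (hH.prodMk hw)).indicator (hA a)
      _ = ∑ a, ∫⁻ H, ∫⁻ w, ENNReal.ofReal (g i H (a, w)) * F (H, (a, w)) ∂ν
            ∂(μ.map (history O i)) := by
          refine Finset.sum_congr rfl fun a _ => ?_
          rw [← lintegral_map (hsec a) (hH.prodMk hw), h.map_restrict_action i a,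
            lintegral_withDensity_eq_lintegral_mul _ (hd a) (hsec a),
            lintegral_prod _ ((hd a).mul (hsec a)).aemeasurable]
          rfl
      _ = ∫⁻ H, ∫⁻ z, F (H, z) ∂(η H) ∂(μ.map (history O i)) := by
          rw [← lintegral_finsetSum]
          · refine lintegral_congr fun H => ?_
            have hFH : Measurable fun z => F (H, z) := hF.comp measurable_prodMk_left
            rw [hη, lintegral_designLaw (h.measurable_design_apply i H) hFH, lintegral_finsetSum]
            exact fun a _ => ((hd a).mul (hsec a)).comp measurable_prodMk_left
          · exact fun a _ => Measurable.lintegral_prod_right' ((hd a).mul (hsec a))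
  have hcomp := condDistrib_comp (mβ := MeasurableSpace.pi) (μ := μ) (history O i) hOi.aemeasurable hpr
  filter_upwards [ae_of_ae_map hH.aemeasurable key, ae_of_ae_map hH.aemeasurable hcomp]
    with ω h1 h2
  rw [← hη, ← h1, ← Kernel.map_apply _ hpr, ← h2]
  rfl

/-- The tower property with the history frozen; it peels off the last observation in
`lintegral_exp_sum_le_one`. -/
theorem IsContextualBandit.lintegral_condDistrib [NeZero K] [IsProbabilityMeasure μ]
    (h : IsContextualBandit μ O g) (i : ℕ) {Φ : (Fin i → Obs d K) × Obs d K → ℝ≥0∞}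
    (hΦ : Measurable Φ) :
    ∫⁻ ω, Φ (history O i ω, O i ω) ∂μ
      = ∫⁻ ω, ∫⁻ o, Φ (history O i ω, o)
          ∂(condDistrib (O i) (history O i) μ (history O i ω)) ∂μ := by
  have hH := h.measurable_history i
  rw [← lintegral_map hΦ (hH.prodMk (h.measurable_obs i)),
    ← compProd_map_condDistrib (h.measurable_obs i).aemeasurable, Measure.lintegral_compProd hΦ,
    lintegral_map _ hH]
  exact hΦ.lintegral_kernel_prod_right'

end Bandit

/-! ### Exponential moments of a nonnegative variable -/

/-- Because exp y ≥ 1 + y + y²/2 and (1 - y + y²/2)(1 + y + y²/2) = 1 + y⁴/4 ≥ 1. -/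
theorem exp_neg_le_one_sub_add_sq {y : ℝ} (hy : 0 ≤ y) : Real.exp (-y) ≤ 1 - y + y ^ 2 / 2 := by
  have h1 := Real.quadratic_le_exp_of_nonneg hy
  have h2 : 0 < 1 - y + y ^ 2 / 2 := by nlinarith [sq_nonneg (y - 1)]
  rw [Real.exp_neg, inv_le_iff_one_le_mul₀ (Real.exp_pos y)]
  nlinarith [mul_le_mul_of_nonneg_left h1 h2.le, sq_nonneg (y ^ 2)]

/-- For a nonnegative random variable the lower tail is sub-Gaussian with variance proxy the second
moment. -/
theorem lintegral_exp_centered_le_one {S : Type*} [MeasurableSpace S] {κ : Measure S}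
    [IsProbabilityMeasure κ] {X : S → ℝ} (hX : Integrable X κ) (hX2 : Integrable (fun s => X s ^ 2) κ)
    (h0 : ∀ s, 0 ≤ X s) {t q : ℝ} (ht : 0 ≤ t) (hq : ∫ s, X s ^ 2 ∂κ ≤ q) :
    ∫⁻ s, ENNReal.ofReal (Real.exp (t * (∫ s, X s ∂κ - X s) - t ^ 2 / 2 * q)) ∂κ ≤ 1 := by
  set m := ∫ s, X s ∂κ with hm
  -- Nonnegativity of `t * X s` is what makes the quadratic bound valid with no upper bound on `X`
  -- entering the constants.
  have hle : ∀ s, Real.exp (t * (m - X s) - t ^ 2 / 2 * q)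
      ≤ Real.exp (t * m - t ^ 2 / 2 * q) * (1 - t * X s + t ^ 2 / 2 * X s ^ 2) := fun s => by
    have := exp_neg_le_one_sub_add_sq (mul_nonneg ht (h0 s))
    calc _ = Real.exp (t * m - t ^ 2 / 2 * q) * Real.exp (-(t * X s)) := by
          rw [← Real.exp_add]; ring_nf
      _ ≤ _ := by
          refine mul_le_mul_of_nonneg_left (this.trans_eq ?_) (Real.exp_pos _).le
          ring
  have hi1 : Integrable (fun s => 1 - t * X s) κ := (integrable_const 1).sub (hX.const_mul t)
  have hint : Integrable (fun s => Real.exp (t * m - t ^ 2 / 2 * q)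
      * (1 - t * X s + t ^ 2 / 2 * X s ^ 2)) κ :=
    (hi1.add (hX2.const_mul (t ^ 2 / 2))).const_mul _
  calc _ ≤ ∫⁻ s, ENNReal.ofReal (Real.exp (t * m - t ^ 2 / 2 * q)
        * (1 - t * X s + t ^ 2 / 2 * X s ^ 2)) ∂κ :=
        lintegral_mono fun s => ENNReal.ofReal_le_ofReal (hle s)
    _ = ENNReal.ofReal (∫ s, Real.exp (t * m - t ^ 2 / 2 * q)
        * (1 - t * X s + t ^ 2 / 2 * X s ^ 2) ∂κ) :=
        (ofReal_integral_eq_lintegral_ofReal hint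
          (Filter.Eventually.of_forall fun s => (Real.exp_pos _).le.trans (hle s))).symm
    _ ≤ 1 := by
        rw [ENNReal.ofReal_le_one, integral_const_mul,
          integral_add hi1 (hX2.const_mul _), integral_sub (integrable_const 1) (hX.const_mul t),
          integral_const_mul, integral_const_mul, ← hm]
        simp only [integral_const, probReal_univ, one_smul]
        have h1 : 1 - t * m + t ^ 2 / 2 * ∫ s, X s ^ 2 ∂κ
            ≤ Real.exp (-(t * m - t ^ 2 / 2 * q)) := by
          have := Real.add_one_le_exp (-(t * m - t ^ 2 / 2 * q))
          nlinarith [mul_le_mul_of_nonneg_left hq (by positivity : 0 ≤ t ^ 2 / 2)]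
        calc _ ≤ Real.exp (t * m - t ^ 2 / 2 * q) * Real.exp (-(t * m - t ^ 2 / 2 * q)) :=
              mul_le_mul_of_nonneg_left h1 (Real.exp_pos _).le
          _ = 1 := by rw [← Real.exp_add]; simp

/-! ### Second moments of the importance-weighted loss -/

/-- The expectation over a context `W` of `∑ a, h(a|W)² / γ(a|W)`. -/
def isQuad {d K : ℕ} (ν : Measure (Context d)) (γ h : Fin K × Context d → ℝ) : ℝ :=
  ∫ w, ∑ a, h (a, w) ^ 2 / γ (a, w) ∂ν

section Moments

variable {d K : ℕ} {ν : Measure (Context d)} {γ h f : Fin K × Context d → ℝ} {δ : ℝ}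

theorem measurable_isLoss (hγ : Measurable γ) (hh : Measurable h) : Measurable (isLoss γ h) := by
  have h1 : Measurable fun o : Obs d K => (o.2.1, o.1) := by fun_prop
  have h3 : Measurable fun o : Obs d K => ((o.2.2 : ℕ) : ℝ) :=
    (measurable_of_countable fun y : Fin 2 => ((y : ℕ) : ℝ)).comp
      (measurable_snd.comp measurable_snd)
  exact ((hh.comp h1).div (hγ.comp h1)).mul (measurable_const.sub h3)

theorem one_sub_reward_mem (y : Fin 2) : 1 - ((y : ℕ) : ℝ) ∈ Set.Icc (0 : ℝ) 1 := by
  fin_cases y <;> simp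

theorem isLoss_nonneg (hγ : ∀ a w, 0 ≤ γ (a, w)) (hh : ∀ z, 0 ≤ h z) (o : Obs d K) :
    0 ≤ isLoss γ h o :=
  mul_nonneg (div_nonneg (hh _) (hγ _ _)) (one_sub_reward_mem _).1

theorem isLoss_le (hδ : 0 < δ) (hγ : ∀ a w, δ ≤ γ (a, w)) (hh : ∀ z, h z ∈ Set.Icc (0 : ℝ) 1)
    (o : Obs d K) : isLoss γ h o ≤ 1 / δ := by
  have h1 : h (o.2.1, o.1) / γ (o.2.1, o.1) ≤ 1 / δ :=
    div_le_div₀ zero_le_one (hh _).2 hδ (hγ _ _)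
  have h2 := one_sub_reward_mem o.2.2
  calc isLoss γ h o ≤ 1 / δ * 1 :=
        mul_le_mul h1 h2.2 h2.1 (by positivity)
    _ = 1 / δ := mul_one _

theorem isLoss_sub (o : Obs d K) : isLoss γ (f - h) o = isLoss γ f o - isLoss γ h o := by
  simp only [isLoss, Pi.sub_apply]; ring

theorem integrable_of_mem_Icc {S : Type*} [MeasurableSpace S] {κ : Measure S} [IsFiniteMeasure κ]
    {X : S → ℝ} (hX : Measurable X) {b : ℝ} (h : ∀ s, X s ∈ Set.Icc 0 b) : Integrable X κ :=
  Integrable.of_bound hX.aestronglyMeasurable b (Filter.Eventually.of_forall fun s => by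
    rw [Real.norm_eq_abs, abs_of_nonneg (h s).1]; exact (h s).2)

theorem integrable_isLoss {κ : Measure (Obs d K)} [IsFiniteMeasure κ] (hδ : 0 < δ)
    (hγm : Measurable γ) (hγ : ∀ a w, δ ≤ γ (a, w)) (hhm : Measurable h)
    (hh : ∀ z, h z ∈ Set.Icc (0 : ℝ) 1) : Integrable (isLoss γ h) κ :=
  integrable_of_mem_Icc (measurable_isLoss hγm hhm) fun o =>
    ⟨isLoss_nonneg (fun a w => hδ.le.trans (hγ a w)) (fun z => (hh z).1) o, isLoss_le hδ hγ hh o⟩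

theorem integrable_isLoss_sq {κ : Measure (Obs d K)} [IsFiniteMeasure κ] (hδ : 0 < δ)
    (hγm : Measurable γ) (hγ : ∀ a w, δ ≤ γ (a, w)) (hhm : Measurable h)
    (hh : ∀ z, h z ∈ Set.Icc (0 : ℝ) 1) : Integrable (fun o => isLoss γ h o ^ 2) κ :=
  integrable_of_mem_Icc ((measurable_isLoss hγm hhm).pow_const 2) fun o =>
    ⟨sq_nonneg _, pow_le_pow_left₀
      (isLoss_nonneg (fun a w => hδ.le.trans (hγ a w)) (fun z => (hh z).1) o)
      (isLoss_le hδ hγ hh o) 2⟩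

/-- The reward factor is at most one, and drawing the action from `γ` cancels one of the two factors
`1 / γ` in the square. -/
theorem integral_isLoss_sq_le [SFinite ν] {κ : Measure (Obs d K)} [IsProbabilityMeasure κ]
    (hκ : κ.map (fun o => (o.2.1, o.1)) = designLaw ν γ) (hδ : 0 < δ) (hγm : Measurable γ)
    (hγ : ∀ a w, δ ≤ γ (a, w)) (hhm : Measurable h) (hh : ∀ z, h z ∈ Set.Icc (0 : ℝ) 1) :
    ∫ o, isLoss γ h o ^ 2 ∂κ ≤ isQuad ν γ h := by
  have hpr : Measurable fun o : Obs d K => (o.2.1, o.1) := by fun_prop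
  have hγ0 : ∀ a w, 0 < γ (a, w) := fun a w => hδ.trans_le (hγ a w)
  have hrm : Measurable fun z => (h z / γ z) ^ 2 := (hhm.div hγm).pow_const 2
  have hint : Integrable (fun o : Obs d K => (h (o.2.1, o.1) / γ (o.2.1, o.1)) ^ 2) κ :=
    integrable_of_mem_Icc (hrm.comp hpr) (b := (1 / δ) ^ 2) fun o => ⟨sq_nonneg _,
      pow_le_pow_left₀ (div_nonneg (hh _).1 (hγ0 _ _).le)
        (div_le_div₀ zero_le_one (hh _).2 hδ (hγ _ _)) 2⟩
  calc ∫ o, isLoss γ h o ^ 2 ∂κ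
      ≤ ∫ o, (h (o.2.1, o.1) / γ (o.2.1, o.1)) ^ 2 ∂κ := by
        refine integral_mono (integrable_isLoss_sq hδ hγm hγ hhm hh) hint fun o => ?_
        have h2 := one_sub_reward_mem o.2.2
        refine pow_le_pow_left₀ (isLoss_nonneg (fun a w => (hγ0 a w).le) (fun z => (hh z).1) o) ?_ 2
        exact mul_le_of_le_one_right (div_nonneg (hh _).1 (hγ0 _ _).le) h2.2
    _ = ∫ z, (h z / γ z) ^ 2 ∂designLaw ν γ := by
        rw [← hκ, integral_map hpr.aemeasurable hrm.aestronglyMeasurable]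
    _ = isQuad ν γ h := by
        rw [isQuad, integral_eq_lintegral_of_nonneg_ae
            (Filter.Eventually.of_forall fun z => sq_nonneg _) hrm.aestronglyMeasurable,
          lintegral_designLaw hγm hrm.ennreal_ofReal, integral_eq_lintegral_of_nonneg_ae]
        · congr 1
          refine lintegral_congr fun w => ?_
          rw [ENNReal.ofReal_sum_of_nonneg fun a _ => div_nonneg (sq_nonneg _) (hγ0 a w).le]
          refine Finset.sum_congr rfl fun a _ => ?_
          rw [← ENNReal.ofReal_mul (hγ0 a w).le]
          congr 1
          field_simp [(hγ0 a w).ne']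
        · exact Filter.Eventually.of_forall fun w =>
            Finset.sum_nonneg fun a _ => div_nonneg (sq_nonneg _) (hγ0 a w).le
        · refine (Finset.measurable_fun_sum _ fun a _ => ?_).aestronglyMeasurable
          exact ((hhm.pow_const 2).div hγm).comp measurable_prodMk_left

/-- Pointwise h² ≤ η f for almost every context. One factor `h` pays for the radius, the other is
traded for `f`, so that the IS ratio of `f` itself controls the variance. -/
theorem isQuad_le_mul [IsFiniteMeasure ν] (hδ : 0 < δ) (hγm : Measurable γ)
    (hγ : ∀ a w, δ ≤ γ (a, w)) (hfm : Measurable f) (hf : ∀ z, f z ∈ Set.Icc (0 : ℝ) 1)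
    (h0 : ∀ z, 0 ≤ h z) (hhf : ∀ z, h z ≤ f z) {η : ℝ} (hη : ∀ a, ∀ᵐ w ∂ν, h (a, w) ≤ η) :
    isQuad ν γ h ≤ η * ∫ w, ∑ a, f (a, w) / γ (a, w) ∂ν := by
  have hγ0 : ∀ a w, 0 < γ (a, w) := fun a w => hδ.trans_le (hγ a w)
  rw [isQuad, ← integral_const_mul]
  refine integral_mono_of_nonneg (Filter.Eventually.of_forall fun w =>
    Finset.sum_nonneg fun a _ => div_nonneg (sq_nonneg _) (hγ0 a w).le) ?_ ?_
  · refine (integrable_finsetSum _ fun a _ => ?_).const_mul η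
    refine integrable_of_mem_Icc (b := 1 / δ) ((hfm.div hγm).comp measurable_prodMk_left)
      fun w => ⟨div_nonneg (hf _).1 (hγ0 a w).le, div_le_div₀ zero_le_one (hf _).2 hδ (hγ _ _)⟩
  · filter_upwards [ae_all_iff.2 hη] with w hw
    simp only [Finset.mul_sum]
    refine Finset.sum_le_sum fun a _ => ?_
    rw [← mul_div_assoc]
    refine div_le_div_of_nonneg_right ?_ (hγ0 a w).le
    rw [sq]
    exact mul_le_mul (hw a) (hhf _) (h0 _) ((h0 _).trans (hw a))

end Moments

/-! ### Exponential supermartingale and deviation of a single function -/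

section Supermartingale

variable {Ω : Type*} [MeasurableSpace Ω] {d K : ℕ} [NeZero K]

/-- The compensated increment at time `i`, as a function of the history and of the current
observation. -/
def expIncrement (μ : Measure Ω) [IsFiniteMeasure μ] (O : ℕ → Ω → Obs d K) (g : Designs d K)
    (h : Fin K × Context d → ℝ) (t : ℝ) (i : ℕ) (p : (Fin i → Obs d K) × Obs d K) : ℝ :=
  t * (∫ o, isLoss (g i p.1) h o ∂(condDistrib (O i) (history O i) μ p.1) - isLoss (g i p.1) h p.2)
    - t ^ 2 / 2 * isQuad (μ.map fun ω => (O 0 ω).1) (g i p.1) h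

variable {μ : Measure Ω} [IsProbabilityMeasure μ] {O : ℕ → Ω → Obs d K} {g : Designs d K}
  {h : Fin K × Context d → ℝ} {δ : ℝ}

theorem measurable_expIncrement (hb : IsContextualBandit μ O g) (hh : Measurable h) (t : ℝ)
    (i : ℕ) : Measurable (expIncrement μ O g h t i) := by
  have hw0 : Measurable fun ω => (O 0 ω).1 := measurable_fst.comp (hb.measurable_obs 0)
  have : IsProbabilityMeasure (μ.map fun ω => (O 0 ω).1) :=
    Measure.isProbabilityMeasure_map hw0.aemeasurable
  have hF : Measurable fun p : (Fin i → Obs d K) × Obs d K => isLoss (g i p.1) h p.2 := by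
    have h1 : Measurable fun p : (Fin i → Obs d K) × Obs d K => (p.2.2.1, p.2.1) := by fun_prop
    have h2 : Measurable fun p : (Fin i → Obs d K) × Obs d K => g i p.1 (p.2.2.1, p.2.1) :=
      (hb.measurable_design i).comp (measurable_fst.prodMk h1)
    have h3 : Measurable fun p : (Fin i → Obs d K) × Obs d K => ((p.2.2.2 : ℕ) : ℝ) :=
      (measurable_of_countable fun y : Fin 2 => ((y : ℕ) : ℝ)).comp
        (measurable_snd.comp (measurable_snd.comp measurable_snd))
    exact ((hh.comp h1).div h2).mul (measurable_const.sub h3)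
  have hI : Measurable fun H : Fin i → Obs d K =>
      ∫ o, isLoss (g i H) h o ∂(condDistrib (O i) (history O i) μ H) :=
    (hF.stronglyMeasurable.integral_condDistrib (X := history O i) (Y := O i) (μ := μ)).measurable
  have hQ : Measurable fun H : Fin i → Obs d K =>
      isQuad (μ.map fun ω => (O 0 ω).1) (g i H) h := by
    have : Measurable fun p : (Fin i → Obs d K) × Context d =>
        ∑ a, h (a, p.2) ^ 2 / g i p.1 (a, p.2) := by
      refine Finset.measurable_fun_sum _ fun a _ => ?_
      have h1 : Measurable fun p : (Fin i → Obs d K) × Context d => (a, p.2) :=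
        measurable_const.prodMk measurable_snd
      exact ((hh.comp h1).pow_const 2).div
        ((hb.measurable_design i).comp (measurable_fst.prodMk h1))
    exact this.stronglyMeasurable.integral_prod_right'.measurable
  exact (((hI.comp measurable_fst).sub hF).const_mul t).sub
    ((hQ.comp measurable_fst).const_mul (t ^ 2 / 2))

/-- Given the history, the last factor has conditional mean at most one by
`lintegral_exp_centered_le_one`, so integrating it out reduces `n + 1` to `n`. -/
theorem lintegral_exp_sum_le_one (hb : IsContextualBandit μ O g) (hδ : 0 < δ) (hhm : Measurable h)
    (hh : ∀ z, h z ∈ Set.Icc (0 : ℝ) 1) {t : ℝ} (ht : 0 ≤ t) (n : ℕ)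
    (hg : ∀ᵐ ω ∂μ, ∀ i < n, ∀ a w, δ ≤ g i (history O i ω) (a, w)) :
    ∫⁻ ω, ENNReal.ofReal (Real.exp
      (∑ i ∈ Finset.range n, expIncrement μ O g h t i (history O i ω, O i ω))) ∂μ ≤ 1 := by
  have hw0 : Measurable fun ω => (O 0 ω).1 := measurable_fst.comp (hb.measurable_obs 0)
  have : IsProbabilityMeasure (μ.map fun ω => (O 0 ω).1) :=
    Measure.isProbabilityMeasure_map hw0.aemeasurable
  induction n with
  | zero => simp
  | succ n ih =>
    -- The past exponent is rewritten as a function of the history, hence a constant under the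
    -- conditional distribution.
    let S : (Fin n → Obs d K) → ℝ := fun H => ∑ i : Fin n,
      expIncrement μ O g h t i (fun j : Fin i => H ⟨j, j.2.trans i.2⟩, H i)
    have hS : Measurable S := Finset.measurable_fun_sum _ fun i _ =>
      (measurable_expIncrement hb hhm t i).comp (by fun_prop)
    have hSh : ∀ ω, S (history O n ω)
        = ∑ i ∈ Finset.range n, expIncrement μ O g h t i (history O i ω, O i ω) := fun ω =>
      (Finset.sum_range fun i => expIncrement μ O g h t i (history O i ω, O i ω)).symm
    have hΦ : Measurable fun p : (Fin n → Obs d K) × Obs d K =>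
        ENNReal.ofReal (Real.exp (S p.1))
          * ENNReal.ofReal (Real.exp (expIncrement μ O g h t n p)) :=
      (Real.measurable_exp.comp (hS.comp measurable_fst)).ennreal_ofReal.mul
        (Real.measurable_exp.comp (measurable_expIncrement hb hhm t n)).ennreal_ofReal
    calc _ = ∫⁻ ω, ENNReal.ofReal (Real.exp (S (history O n ω))) * ENNReal.ofReal
            (Real.exp (expIncrement μ O g h t n (history O n ω, O n ω))) ∂μ := by
          refine lintegral_congr fun ω => ?_
          rw [Finset.sum_range_succ, Real.exp_add, ENNReal.ofReal_mul (Real.exp_pos _).le, hSh]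
      _ = ∫⁻ ω, ∫⁻ o, ENNReal.ofReal (Real.exp (S (history O n ω))) * ENNReal.ofReal
            (Real.exp (expIncrement μ O g h t n (history O n ω, o)))
            ∂(condDistrib (O n) (history O n) μ (history O n ω)) ∂μ :=
          hb.lintegral_condDistrib n hΦ
      _ ≤ ∫⁻ ω, ENNReal.ofReal (Real.exp (S (history O n ω))) ∂μ := by
          refine lintegral_mono_ae ?_
          filter_upwards [hg, hb.condDistrib_action_context n] with ω hω hκ
          rw [lintegral_const_mul']
          · have hγm := hb.measurable_design_apply n (history O n ω)
            have hγ := hω n n.lt_succ_self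
            refine mul_le_of_le_one_right' ?_
            exact lintegral_exp_centered_le_one (integrable_isLoss hδ hγm hγ hhm hh)
              (integrable_isLoss_sq hδ hγm hγ hhm hh)
              (isLoss_nonneg (fun a w => hδ.le.trans (hγ a w)) fun z => (hh z).1) ht
              (integral_isLoss_sq_le hκ hδ hγm hγ hhm hh)
          · exact ENNReal.ofReal_ne_top
      _ ≤ 1 := by
          simp only [hSh]
          exact ih (hg.mono fun ω hω i hi => hω i (hi.trans n.lt_succ_self))

/-- A one-sided Bernstein inequality without a linear term, for a single nonnegative function. -/
theorem measure_isProcess_ge_le (hb : IsContextualBandit μ O g) (hδ : 0 < δ) (hhm : Measurable h)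
    (hh : ∀ z, h z ∈ Set.Icc (0 : ℝ) 1) {n : ℕ} (hn : 1 ≤ n)
    (hg : ∀ᵐ ω ∂μ, ∀ i < n, ∀ a w, δ ≤ g i (history O i ω) (a, w)) {b t : ℝ} (hb0 : 0 < b)
    (ht : 0 ≤ t) :
    μ {ω | (n : ℝ)⁻¹ * ∑ i ∈ Finset.range n,
            isQuad (μ.map fun ω => (O 0 ω).1) (g i (history O i ω)) h ≤ b
          ∧ √(2 * b * t / n) ≤ isProcess μ O g n h ω} ≤ ENNReal.ofReal (Real.exp (-t)) := by
  have hn0 : (0 : ℝ) < n := by exact_mod_cast hn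
  set s := √(2 * b * t / n) with hs
  have hs0 : 0 ≤ s := Real.sqrt_nonneg _
  have hs2 : s ^ 2 = 2 * b * t / n := Real.sq_sqrt (by positivity)
  have hZm : Measurable fun ω => ENNReal.ofReal (Real.exp
      (∑ i ∈ Finset.range n, expIncrement μ O g h (s / b) i (history O i ω, O i ω))) :=
    (Real.measurable_exp.comp (Finset.measurable_fun_sum _ fun i _ =>
      (measurable_expIncrement hb hhm (s / b) i).comp
        ((hb.measurable_history i).prodMk (hb.measurable_obs i)))).ennreal_ofReal
  -- Markov's inequality at the multiplier λ = s/b, which maximises λns - λ²nb/2; by the choice of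
  -- `s` the maximum is `t`.
  have hM := (mul_meas_ge_le_lintegral hZm (ENNReal.ofReal (Real.exp t))).trans
    (lintegral_exp_sum_le_one hb hδ hhm hh (div_nonneg hs0 hb0.le) n hg)
  rw [Real.exp_neg, ENNReal.ofReal_inv_of_pos (Real.exp_pos t), ENNReal.le_inv_iff_mul_le, mul_comm]
  refine le_trans (mul_le_mul_right (measure_mono ?_) _) hM
  rintro ω ⟨hQ, hP⟩
  refine ENNReal.ofReal_le_ofReal (Real.exp_le_exp.2 ?_)
  simp only [expIncrement, Finset.sum_sub_distrib, ← Finset.mul_sum]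
  rw [inv_mul_le_iff₀ hn0] at hQ
  rw [isProcess, le_inv_mul_iff₀ hn0] at hP
  simp only [Finset.sum_sub_distrib] at hP
  have h1 : s / b * (n * s) - (s / b) ^ 2 / 2 * (n * b) = t := by
    have : s / b * (n * s) - (s / b) ^ 2 / 2 * (n * b) = s ^ 2 * n / (2 * b) := by
      field_simp; ring
    rw [this, hs2]; field_simp
  rw [← h1]
  exact sub_le_sub (mul_le_mul_of_nonneg_left hP (div_nonneg hs0 hb0.le))
    (mul_le_mul_of_nonneg_left hQ (by positivity))

end Supermartingale

/-! ### Pathwise bounds for functions below `f` -/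

theorem sq_integral_le_integral_sq {S : Type*} [MeasurableSpace S] {κ : Measure S}
    [IsProbabilityMeasure κ] {X : S → ℝ} (hX : Integrable X κ)
    (hX2 : Integrable (fun s => X s ^ 2) κ) : (∫ s, X s ∂κ) ^ 2 ≤ ∫ s, X s ^ 2 ∂κ := by
  set m := ∫ s, X s ∂κ with hm
  have h0 : 0 ≤ ∫ s, (X s - m) ^ 2 ∂κ := integral_nonneg fun s => sq_nonneg _
  have h1 : ∀ s, (X s - m) ^ 2 = X s ^ 2 - 2 * m * X s + m ^ 2 := fun s => by ring
  simp only [h1] at h0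
  have hi : Integrable (fun s => X s ^ 2 - 2 * m * X s) κ := hX2.sub (hX.const_mul _)
  rw [integral_add hi (integrable_const _),
    integral_sub hX2 (hX.const_mul _), integral_const_mul, ← hm] at h0
  simp only [integral_const, probReal_univ, one_smul] at h0
  nlinarith

section Approximation

variable {Ω : Type*} [MeasurableSpace Ω] {d K : ℕ} {μ : Measure Ω} {O : ℕ → Ω → Obs d K} {g : Designs d K}
  {f h l : Fin K × Context d → ℝ} {δ η v : ℝ} {n : ℕ} {ω : Ω}

/-- Every action has positive mass under the uniform law, so no exceptional action survives. -/
theorem ae_context_of_ae_refLaw [SFinite μ] {p : Fin K × Context d → Prop}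
    (hp : ∀ᵐ z ∂refLaw μ O, p z) (a : Fin K) :
    ∀ᵐ w ∂(μ.map fun ω => (O 0 ω).1), p (a, w) := by
  have h1 := Measure.ae_ae_of_ae_prod hp
  have h2 : uniformOn (Set.univ : Set (Fin K)) {a} ≠ 0 := by
    rw [uniformOn_univ]
    simp
  by_contra hcon
  exact h2 (measure_mono_null (fun b hb => by rw [Set.mem_singleton_iff.1 hb]; exact hcon) h1)

variable [IsProbabilityMeasure μ]

theorem avg_isQuad_le (hb : IsContextualBandit μ O g) (hδ : 0 < δ)
    (hγ : ∀ i < n, ∀ a w, δ ≤ g i (history O i ω) (a, w))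
    (hfm : Measurable f) (hf : ∀ z, f z ∈ Set.Icc (0 : ℝ) 1)
    (h0 : ∀ z, 0 ≤ h z) (hhf : ∀ z, h z ≤ f z) (hη0 : 0 ≤ η)
    (hη : ∀ a, ∀ᵐ w ∂(μ.map fun ω => (O 0 ω).1), h (a, w) ≤ η) (hv : avgIsRatio μ O g n f ω ≤ v) :
    (n : ℝ)⁻¹ * ∑ i ∈ Finset.range n,
      isQuad (μ.map fun ω => (O 0 ω).1) (g i (history O i ω)) h ≤ η * v := by
  calc _ ≤ (n : ℝ)⁻¹ * ∑ i ∈ Finset.range n, η * isRatio μ O g i f ω := by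
        refine mul_le_mul_of_nonneg_left (Finset.sum_le_sum fun i hi => ?_) (by positivity)
        exact isQuad_le_mul hδ (hb.measurable_design_apply i _) (hγ i (Finset.mem_range.1 hi)) hfm
          hf h0 hhf hη
    _ = η * avgIsRatio μ O g n f ω := by
        rw [← Finset.mul_sum, avgIsRatio]; ring
    _ ≤ η * v := mul_le_mul_of_nonneg_left hv hη0

variable [NeZero K]

theorem isProcess_sub (hb : IsContextualBandit μ O g) (hδ : 0 < δ)
    (hγ : ∀ i < n, ∀ a w, δ ≤ g i (history O i ω) (a, w))
    (hfm : Measurable f) (hf : ∀ z, f z ∈ Set.Icc (0 : ℝ) 1)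
    (hlm : Measurable l) (hl : ∀ z, l z ∈ Set.Icc (0 : ℝ) 1) :
    isProcess μ O g n (f - l) ω = isProcess μ O g n f ω - isProcess μ O g n l ω := by
  rw [isProcess, isProcess, isProcess, ← mul_sub, ← Finset.sum_sub_distrib]
  congr 1
  refine Finset.sum_congr rfl fun i hi => ?_
  have hγi := hγ i (Finset.mem_range.1 hi)
  have hγm := hb.measurable_design_apply i (history O i ω)
  have : condLoss μ O g i (f - l) ω = condLoss μ O g i f ω - condLoss μ O g i l ω := by
    rw [condLoss, condLoss, condLoss, ← integral_sub (integrable_isLoss hδ hγm hγi hfm hf)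
      (integrable_isLoss hδ hγm hγi hlm hl)]
    exact integral_congr_ae (Filter.Eventually.of_forall fun o => isLoss_sub o)
  rw [this, isLoss_sub]
  ring

/-- The process is bounded from above by its compensator, which the Cauchy-Schwarz inequality bounds
by the root of the averaged second moments. -/
theorem isProcess_le_sqrt (hb : IsContextualBandit μ O g) (hδ : 0 < δ)
    (hγ : ∀ i < n, ∀ a w, δ ≤ g i (history O i ω) (a, w))
    (hκ : ∀ i < n, (condDistrib (O i) (history O i) μ (history O i ω)).map (fun o => (o.2.1, o.1))
      = designLaw (μ.map fun ω => (O 0 ω).1) (g i (history O i ω)))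
    (hhm : Measurable h) (hh : ∀ z, h z ∈ Set.Icc (0 : ℝ) 1) {b : ℝ}
    (hq : (n : ℝ)⁻¹ * ∑ i ∈ Finset.range n,
      isQuad (μ.map fun ω => (O 0 ω).1) (g i (history O i ω)) h ≤ b) :
    isProcess μ O g n h ω ≤ √b := by
  have hw0 : Measurable fun ω => (O 0 ω).1 := measurable_fst.comp (hb.measurable_obs 0)
  have : IsProbabilityMeasure (μ.map fun ω => (O 0 ω).1) :=
    Measure.isProbabilityMeasure_map hw0.aemeasurable
  have h1 : isProcess μ O g n h ω
      ≤ (n : ℝ)⁻¹ * ∑ i ∈ Finset.range n, condLoss μ O g i h ω := by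
    refine mul_le_mul_of_nonneg_left (Finset.sum_le_sum fun i hi => ?_) (by positivity)
    exact sub_le_self _ (isLoss_nonneg (fun a w => hδ.le.trans (hγ i (Finset.mem_range.1 hi) a w))
      (fun z => (hh z).1) _)
  refine h1.trans (Real.le_sqrt_of_sq_le (le_trans ?_ hq))
  rcases Nat.eq_zero_or_pos n with rfl | hn
  · simp
  have hn0 : (0 : ℝ) < n := by exact_mod_cast hn
  calc ((n : ℝ)⁻¹ * ∑ i ∈ Finset.range n, condLoss μ O g i h ω) ^ 2
      ≤ (n : ℝ)⁻¹ ^ 2 * (n * ∑ i ∈ Finset.range n, condLoss μ O g i h ω ^ 2) := by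
        rw [mul_pow]
        refine mul_le_mul_of_nonneg_left ?_ (by positivity)
        simpa using sq_sum_le_card_mul_sum_sq (s := Finset.range n)
          (f := fun i => condLoss μ O g i h ω)
    _ = (n : ℝ)⁻¹ * ∑ i ∈ Finset.range n, condLoss μ O g i h ω ^ 2 := by
        field_simp
    _ ≤ _ := by
        refine mul_le_mul_of_nonneg_left (Finset.sum_le_sum fun i hi => ?_) (by positivity)
        have hi' := Finset.mem_range.1 hi
        have hγm := hb.measurable_design_apply i (history O i ω)
        exact (sq_integral_le_integral_sq (integrable_isLoss hδ hγm (hγ i hi') hhm hh)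
          (integrable_isLoss_sq hδ hγm (hγ i hi') hhm hh)).trans
          (integral_isLoss_sq_le (hκ i hi') hδ hγm (hγ i hi') hhm hh)

end Approximation

/-! ### Bracketing numbers and the entropy integral -/

theorem logOneAdd_mono : Monotone logOneAdd := fun M N h =>
  EReal.toENNReal_le_toENNReal (ENNReal.log_monotone (by gcongr))

theorem logOneAdd_top : logOneAdd ⊤ = ⊤ := by simp [logOneAdd]

theorem logOneAdd_natCast (N : ℕ) : logOneAdd N = ENNReal.ofReal (Real.log (1 + N)) := by
  have : (1 + ((N : ℕ∞) : ℝ≥0∞)) = ENNReal.ofReal (1 + N) := by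
    rw [ENNReal.ofReal_add zero_le_one (Nat.cast_nonneg N)]; simp
  rw [logOneAdd, this, ENNReal.log_ofReal_of_pos (by positivity),
    EReal.toENNReal_of_ne_top (EReal.coe_ne_top _), EReal.toReal_coe]

section Bracketing

variable {X : Type*} [MeasurableSpace X] {F : Set (X → ℝ)} {ν : Measure X}

theorem bracketingNumber_antitone (F : Set (X → ℝ)) (p : ℝ≥0∞) (ν : Measure X) :
    Antitone fun η : ℝ => bracketingNumber η F p ν := fun η η' h => by
  refine le_iInf₂ fun N hN => ?_
  obtain ⟨l, u, h1, h2⟩ := hN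
  exact iInf₂_le N ⟨l, u, fun k => ⟨(h1 k).1, (h1 k).2.1,
    (h1 k).2.2.trans (ENNReal.ofReal_le_ofReal h)⟩, h2⟩

/-- The lower ends of the brackets of an optimal bracketing, truncated to `[0, 1]`. -/
theorem exists_lower_brackets (hF : ∀ f ∈ F, ∀ z, f z ∈ Set.Icc (0 : ℝ) 1) {η : ℝ} (hη : 0 ≤ η)
    {N : ℕ} (hN : bracketingNumber η F ∞ ν = N) :
    ∃ l : Fin N → X → ℝ, (∀ k, Measurable (l k) ∧ ∀ z, l k z ∈ Set.Icc (0 : ℝ) 1) ∧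
      ∀ f ∈ F, ∃ k, (∀ z, l k z ≤ f z) ∧ ∀ᵐ z ∂ν, f z - l k z ≤ η := by
  have hex : ∃ l u : Fin N → X → ℝ,
      (∀ k, Measurable (l k) ∧ Measurable (u k) ∧ eLpNorm (u k - l k) ∞ ν ≤ ENNReal.ofReal η) ∧
      ∀ f ∈ F, ∃ k, ∀ x, l k x ≤ f x ∧ f x ≤ u k x := by
    by_contra hcon
    -- The infimum is attained: otherwise every admissible number of brackets is at least `N + 1`.
    have : ((N : ℕ∞) + 1) ≤ bracketingNumber η F ∞ ν := by
      refine le_iInf₂ fun M hM => ?_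
      have h1 : (N : ℕ∞) ≤ M := hN ▸ iInf₂_le M hM
      have h2 : N ≠ M := by rintro rfl; exact hcon hM
      exact_mod_cast Nat.succ_le_of_lt (lt_of_le_of_ne (by exact_mod_cast h1) h2)
    rw [hN] at this
    exact absurd (by exact_mod_cast this : N + 1 ≤ N) (by omega)
  obtain ⟨l, u, h1, h2⟩ := hex
  refine ⟨fun k z => min (max (l k z) 0) 1, fun k => ⟨?_, fun z => ?_⟩, fun f hf => ?_⟩
  · exact ((h1 k).1.max measurable_const).min measurable_const
  · exact ⟨le_min (le_max_right _ _) zero_le_one, min_le_right _ _⟩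
  · obtain ⟨k, hk⟩ := h2 f hf
    refine ⟨k, fun z => (min_le_left _ _).trans (max_le (hk z).1 (hF f hf z).1), ?_⟩
    have h3 := (h1 k).2.2
    rw [eLpNorm_exponent_top] at h3
    filter_upwards [ae_le_eLpNormEssSup (f := u k - l k) (μ := ν)] with z hz
    have h4 : u k z - l k z ≤ η := by
      have := hz.trans h3
      rw [← ofReal_norm, ENNReal.ofReal_le_ofReal_iff hη] at this
      exact (le_abs_self _).trans this
    -- On a bracket that contains `f ≤ 1`, truncation can only raise the lower end, so the gap to
    -- `f` does not grow.
    have h5 : l k z ≤ min (max (l k z) 0) 1 :=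
      le_min (le_max_left _ _) ((hk z).1.trans (hF f hf z).2)
    linarith [(hk z).2]

/-- The entropy integral dominates its lower Riemann sums. -/
theorem sum_le_lintegral_entropy (F : Set (X → ℝ)) (ν : Measure X) {a : ℕ → ℝ} (ha : Antitone a)
    (ha0 : ∀ j, 0 ≤ a j) (ha1 : a 0 ≤ 1) (m : ℕ) :
    ∑ j ∈ Finset.range m, ENNReal.ofReal (a j - a (j + 1))
        * logOneAdd (bracketingNumber (a j ^ 2) F ∞ ν) ^ (1 / 2 : ℝ)
      ≤ ∫⁻ u in Set.Ioc (a m) 1, logOneAdd (bracketingNumber (u ^ 2) F ∞ ν) ^ (1 / 2 : ℝ) := by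
  induction m with
  | zero => simp
  | succ m ih =>
    have hle := ha m.le_succ
    have hm1 : a m ≤ 1 := (ha m.zero_le).trans ha1
    have hdisj : Disjoint (Set.Ioc (a m) 1) (Set.Ioc (a (m + 1)) (a m)) :=
      Set.disjoint_left.2 fun u hu hu' => absurd hu.1 hu'.2.not_gt
    rw [Finset.sum_range_succ, ← Set.Ioc_union_Ioc_eq_Ioc hle hm1, Set.union_comm,
      lintegral_union measurableSet_Ioc hdisj]
    refine add_le_add ih ?_
    calc _ = ∫⁻ _ in Set.Ioc (a (m + 1)) (a m),
          logOneAdd (bracketingNumber (a m ^ 2) F ∞ ν) ^ (1 / 2 : ℝ) := by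
          rw [setLIntegral_const, Real.volume_Ioc, mul_comm]
      _ ≤ _ := by
          refine setLIntegral_mono' measurableSet_Ioc fun u hu => ?_
          refine ENNReal.rpow_le_rpow (logOneAdd_mono (bracketingNumber_antitone F ∞ ν ?_))
            (by norm_num)
          exact pow_le_pow_left₀ ((ha0 _).trans hu.1.le) hu.2 2

end Bracketing

/-! ### Geometric sums -/

/-- Summation by parts along a geometric sequence. -/
theorem sum_geometric_mul_partial_sum_le {a b : ℕ → ℝ} {r : ℝ} (hr : r < 1)
    (ha : ∀ j, a (j + 1) = r * a j) (ha0 : ∀ j, 0 ≤ a j) (hb : ∀ j, 0 ≤ b j) (m : ℕ) :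
    ∑ j ∈ Finset.range m, a j * ∑ i ∈ Finset.range (j + 1), b i
      ≤ (1 - r)⁻¹ * ∑ i ∈ Finset.range m, a i * b i := by
  have hC : 0 < 1 - r := sub_pos.2 hr
  have key : ∀ m, ∑ j ∈ Finset.range m, a j * ∑ i ∈ Finset.range (j + 1), b i
      + (1 - r)⁻¹ * a m * ∑ i ∈ Finset.range m, b i
      = (1 - r)⁻¹ * ∑ i ∈ Finset.range m, a i * b i := fun m => by
    induction m with
    | zero => simp
    | succ m ih =>
      rw [Finset.sum_range_succ, Finset.sum_range_succ (fun i => a i * b i), mul_add, ← ih, ha,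
        Finset.sum_range_succ b]
      field_simp
      ring
  rw [← key m]
  have : 0 ≤ ∑ i ∈ Finset.range m, b i := Finset.sum_nonneg fun i _ => hb i
  exact le_add_of_nonneg_right (mul_nonneg (mul_nonneg (inv_nonneg.2 hC.le) (ha0 m)) this)

theorem sqrt_sum_le_sum_sqrt {ι : Type*} (s : Finset ι) {f : ι → ℝ} (hf : ∀ i, 0 ≤ f i) :
    √(∑ i ∈ s, f i) ≤ ∑ i ∈ s, √(f i) := by
  refine Real.sqrt_le_iff.2 ⟨Finset.sum_nonneg fun i _ => Real.sqrt_nonneg _, ?_⟩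
  calc ∑ i ∈ s, f i = ∑ i ∈ s, √(f i) ^ 2 := by simp only [Real.sq_sqrt (hf _)]
    _ ≤ _ := Finset.sum_sq_le_sq_sum_of_nonneg fun i _ => Real.sqrt_nonneg _

/-! ### Monotone chains of lower bracket ends -/

open Classical in
/-- The pointwise maxima of one function from each of the first `j` families. -/
def chainSet {X : Type*} {N : ℕ → ℕ} (l : ∀ j, Fin (N j) → X → ℝ) : ℕ → Finset (X → ℝ)
  | 0 => {0}
  | j + 1 => Finset.image₂ (fun p q => p ⊔ q) (chainSet l j) (Finset.univ.image (l j))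

open Classical in
/-- The increments between two successive elements of a chain. -/
def linkSet {X : Type*} {N : ℕ → ℕ} (l : ∀ j, Fin (N j) → X → ℝ) (j : ℕ) : Finset (X → ℝ) :=
  Finset.image₂ (fun p q => p ⊔ q - p) (chainSet l j) (Finset.univ.image (l j))

section Chain

variable {X : Type*} {N : ℕ → ℕ} {l : ∀ j, Fin (N j) → X → ℝ}

theorem card_chainSet_le (l : ∀ j, Fin (N j) → X → ℝ) (j : ℕ) :
    (chainSet l j).card ≤ ∏ i ∈ Finset.range j, N i := by
  classical
  induction j with
  | zero => simp [chainSet]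
  | succ j ih =>
    rw [chainSet, Finset.prod_range_succ]
    refine (Finset.card_image₂_le _ _ _).trans (Nat.mul_le_mul ih ?_)
    simpa using Finset.card_image_le (s := Finset.univ) (f := l j)

theorem card_linkSet_le (l : ∀ j, Fin (N j) → X → ℝ) (j : ℕ) :
    (linkSet l j).card ≤ ∏ i ∈ Finset.range (j + 1), N i := by
  classical
  rw [linkSet, Finset.prod_range_succ]
  refine (Finset.card_image₂_le _ _ _).trans (Nat.mul_le_mul (card_chainSet_le l j) ?_)
  simpa using Finset.card_image_le (s := Finset.univ) (f := l j)

theorem sup_mem_chainSet {p : X → ℝ} {j : ℕ} (hp : p ∈ chainSet l j) (k : Fin (N j)) :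
    p ⊔ l j k ∈ chainSet l (j + 1) := by
  classical
  exact Finset.mem_image₂_of_mem hp (Finset.mem_image_of_mem _ (Finset.mem_univ k))

theorem sup_sub_mem_linkSet {p : X → ℝ} {j : ℕ} (hp : p ∈ chainSet l j) (k : Fin (N j)) :
    p ⊔ l j k - p ∈ linkSet l j := by
  classical
  exact Finset.mem_image₂_of_mem hp (Finset.mem_image_of_mem _ (Finset.mem_univ k))

variable [MeasurableSpace X]

theorem measurable_mem_Icc_of_mem_chainSet
    (hl : ∀ j k, Measurable (l j k) ∧ ∀ z, l j k z ∈ Set.Icc (0 : ℝ) 1) {j : ℕ} {p : X → ℝ}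
    (hp : p ∈ chainSet l j) : Measurable p ∧ ∀ z, p z ∈ Set.Icc (0 : ℝ) 1 := by
  classical
  induction j generalizing p with
  | zero =>
    rw [chainSet, Finset.mem_singleton] at hp
    subst hp
    exact ⟨measurable_const, fun z => by simp⟩
  | succ j ih =>
    obtain ⟨q, hq, q', hq', rfl⟩ := Finset.mem_image₂.1 hp
    obtain ⟨k, -, rfl⟩ := Finset.mem_image.1 hq'
    exact ⟨(ih hq).1.sup (hl j k).1, fun z =>
      ⟨((ih hq).2 z).1.trans le_sup_left, sup_le ((ih hq).2 z).2 ((hl j k).2 z).2⟩⟩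

theorem measurable_mem_Icc_of_mem_linkSet
    (hl : ∀ j k, Measurable (l j k) ∧ ∀ z, l j k z ∈ Set.Icc (0 : ℝ) 1) {j : ℕ} {h : X → ℝ}
    (hh : h ∈ linkSet l j) : Measurable h ∧ ∀ z, h z ∈ Set.Icc (0 : ℝ) 1 := by
  classical
  obtain ⟨q, hq, q', hq', rfl⟩ := Finset.mem_image₂.1 hh
  obtain ⟨k, -, rfl⟩ := Finset.mem_image.1 hq'
  have h1 := measurable_mem_Icc_of_mem_chainSet hl hq
  have h2 := measurable_mem_Icc_of_mem_chainSet hl (sup_mem_chainSet hq k)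
  refine ⟨h2.1.sub h1.1, fun z => ⟨sub_nonneg.2 le_sup_left, ?_⟩⟩
  have := (h1.2 z).1
  have := (h2.2 z).2
  simp only [Pi.sub_apply]
  linarith

end Chain

/-! ### Union bound over the links and the chaining decomposition -/

section Chaining

variable {Ω : Type*} [MeasurableSpace Ω] {d K : ℕ} [NeZero K] {μ : Measure Ω}
  [IsProbabilityMeasure μ] {O : ℕ → Ω → Obs d K} {g : Designs d K} {δ v : ℝ} {n : ℕ}
  {N : ℕ → ℕ} {l : ∀ j, Fin (N j) → Fin K × Context d → ℝ}

/-- The event that the process at `h` exceeds the threshold of confidence level `exp (-t)` although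
the averaged second moments of `h` are at most `b`. -/
def linkEvent (μ : Measure Ω) [IsFiniteMeasure μ] (O : ℕ → Ω → Obs d K) (g : Designs d K) (n : ℕ)
    (h : Fin K × Context d → ℝ) (b t : ℝ) : Set Ω :=
  {ω | (n : ℝ)⁻¹ * ∑ i ∈ Finset.range n,
          isQuad (μ.map fun ω => (O 0 ω).1) (g i (history O i ω)) h ≤ b
        ∧ √(2 * b * t / n) ≤ isProcess μ O g n h ω}

/-- The factor 2 before the logarithms gives N/(1 + N)² ≤ 1/2 at each level. The confidence level
thus pays for the number of links and leaves a summable geometric factor. -/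
theorem prod_mul_exp_neg_le (N : ℕ → ℕ) (x : ℝ) (j : ℕ) :
    ((∏ i ∈ Finset.range j, N i : ℕ) : ℝ)
        * Real.exp (-(x + 2 * ∑ i ∈ Finset.range j, Real.log (1 + N i)))
      ≤ Real.exp (-x) * (1 / 2) ^ j := by
  have h1 : ∀ i, (N i : ℝ) * Real.exp (-(2 * Real.log (1 + N i))) ≤ 1 / 2 := fun i => by
    have h2 : (0 : ℝ) < 1 + N i := by positivity
    rw [Real.exp_neg, ← div_eq_mul_inv, two_mul, Real.exp_add, Real.exp_log h2,
      div_le_div_iff₀ (by positivity) two_pos]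
    nlinarith [sq_nonneg (N i : ℝ)]
  have h3 : Real.exp (-(x + 2 * ∑ i ∈ Finset.range j, Real.log (1 + N i)))
      = Real.exp (-x) * ∏ i ∈ Finset.range j, Real.exp (-(2 * Real.log (1 + N i))) := by
    rw [← Real.exp_sum, ← Real.exp_add, Finset.sum_neg_distrib, Finset.mul_sum, neg_add]
  rw [h3, Nat.cast_prod, mul_left_comm, ← Finset.prod_mul_distrib]
  refine mul_le_mul_of_nonneg_left ?_ (Real.exp_pos _).le
  calc _ ≤ ∏ _i ∈ Finset.range j, (1 / 2 : ℝ) :=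
        Finset.prod_le_prod (fun i _ => by positivity) fun i _ => h1 i
    _ = (1 / 2) ^ j := by simp

theorem measure_iUnion_linkEvent_le (hb : IsContextualBandit μ O g) (hδ : 0 < δ) (hn : 1 ≤ n)
    (hg : ∀ᵐ ω ∂μ, ∀ i < n, ∀ a w, δ ≤ g i (history O i ω) (a, w))
    (hl : ∀ j k, Measurable (l j k) ∧ ∀ z, l j k z ∈ Set.Icc (0 : ℝ) 1) {b : ℕ → ℝ}
    (hb0 : ∀ j, 0 < b j) {x : ℝ} (hx : 0 ≤ x) (m : ℕ) :
    μ (⋃ j ∈ Finset.range m, ⋃ h ∈ linkSet l j, linkEvent μ O g n h (b j)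
        (x + 2 * ∑ i ∈ Finset.range (j + 1), Real.log (1 + N i)))
      ≤ ENNReal.ofReal (Real.exp (-x)) := by
  have ht : ∀ j, 0 ≤ x + 2 * ∑ i ∈ Finset.range (j + 1), Real.log (1 + N i) := fun j => by
    have : 0 ≤ ∑ i ∈ Finset.range (j + 1), Real.log (1 + N i) :=
      Finset.sum_nonneg fun i _ => Real.log_nonneg (by simp)
    linarith
  calc _ ≤ ∑ j ∈ Finset.range m, ∑ h ∈ linkSet l j, μ (linkEvent μ O g n h (b j)
          (x + 2 * ∑ i ∈ Finset.range (j + 1), Real.log (1 + N i))) :=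
        (measure_biUnion_finset_le _ _).trans
          (Finset.sum_le_sum fun j _ => measure_biUnion_finset_le _ _)
    _ ≤ ∑ j ∈ Finset.range m, ENNReal.ofReal (Real.exp (-x) * (1 / 2) ^ (j + 1)) := by
        refine Finset.sum_le_sum fun j _ => ?_
        calc _ ≤ ∑ h ∈ linkSet l j, ENNReal.ofReal (Real.exp
                (-(x + 2 * ∑ i ∈ Finset.range (j + 1), Real.log (1 + N i)))) := by
              refine Finset.sum_le_sum fun h hh => ?_
              obtain ⟨h1, h2⟩ := measurable_mem_Icc_of_mem_linkSet hl hh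
              exact measure_isProcess_ge_le hb hδ h1 h2 hn hg (hb0 j) (ht j)
          _ = ENNReal.ofReal ((linkSet l j).card * Real.exp
                (-(x + 2 * ∑ i ∈ Finset.range (j + 1), Real.log (1 + N i)))) := by
              rw [Finset.sum_const, nsmul_eq_mul, ENNReal.ofReal_mul (Nat.cast_nonneg _),
                ENNReal.ofReal_natCast]
          _ ≤ _ := by
              refine ENNReal.ofReal_le_ofReal (le_trans ?_ (prod_mul_exp_neg_le N x (j + 1)))
              exact mul_le_mul_of_nonneg_right (by exact_mod_cast card_linkSet_le l j)
                (Real.exp_pos _).le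
    _ = ENNReal.ofReal (Real.exp (-x) * ∑ j ∈ Finset.range m, (1 / 2) ^ (j + 1)) := by
        rw [← ENNReal.ofReal_sum_of_nonneg fun j _ => by positivity, Finset.mul_sum]
    _ ≤ _ := by
        refine ENNReal.ofReal_le_ofReal (mul_le_of_le_one_right (Real.exp_pos _).le ?_)
        have : ∑ j ∈ Finset.range m, (1 / 2 : ℝ) ^ (j + 1) = 1 - (1 / 2) ^ m := by
          induction m with
          | zero => simp
          | succ m ih => rw [Finset.sum_range_succ, ih]; ring
        rw [this]
        have : (0 : ℝ) ≤ (1 / 2) ^ m := by positivity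
        linarith

/-- Approximation of `f` from below along a chain, outside the deviation events of the links. -/
theorem isProcess_le_sum_links (hb : IsContextualBandit μ O g) (hδ : 0 < δ)
    (hl : ∀ j k, Measurable (l j k) ∧ ∀ z, l j k z ∈ Set.Icc (0 : ℝ) 1)
    {η : ℕ → ℝ} (hη0 : ∀ j, 0 ≤ η j) (hη1 : 1 ≤ 2 * η 0) (hη : ∀ j, 2 * η (j + 1) = η j)
    {t : ℕ → ℝ} {m : ℕ} {ω : Ω}
    (hγ : ∀ i < n, ∀ a w, δ ≤ g i (history O i ω) (a, w))
    (hκ : ∀ i < n, (condDistrib (O i) (history O i) μ (history O i ω)).map (fun o => (o.2.1, o.1))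
      = designLaw (μ.map fun ω => (O 0 ω).1) (g i (history O i ω)))
    (hω : ∀ j < m, ∀ h ∈ linkSet l j, ω ∉ linkEvent μ O g n h (2 * η j * v) (t j))
    {f : Fin K × Context d → ℝ} (hfm : Measurable f) (hf : ∀ z, f z ∈ Set.Icc (0 : ℝ) 1)
    (hfl : ∀ j < m, ∃ k, (∀ z, l j k z ≤ f z) ∧ ∀ᵐ z ∂refLaw μ O, f z - l j k z ≤ η j)
    (hfv : avgIsRatio μ O g n f ω ≤ v) :
    isProcess μ O g n f ω ≤ √(2 * η m * v)
      + ∑ j ∈ Finset.range m, √(2 * (2 * η j * v) * t j / n) := by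
  -- Before level `j` the gap is at most `2 * η j`, which is the radius of the preceding level; for
  -- `j = 0` the chain starts at `0` and uses f ≤ 1 ≤ 2η_0.
  have hchain : ∀ j ≤ m, ∃ p ∈ chainSet l j, (∀ z, p z ≤ f z)
      ∧ (∀ a, ∀ᵐ w ∂(μ.map fun ω => (O 0 ω).1), f (a, w) - p (a, w) ≤ 2 * η j)
      ∧ isProcess μ O g n p ω ≤ ∑ j ∈ Finset.range j, √(2 * (2 * η j * v) * t j / n) := by
    intro j
    induction j with
    | zero =>
      refine fun _ => ⟨0, by simp [chainSet], fun z => (hf z).1, fun a => ?_, ?_⟩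
      · refine Filter.Eventually.of_forall fun w => ?_
        simpa using (hf (a, w)).2.trans hη1
      · simp [isProcess, condLoss, isLoss]
    | succ j ih =>
      intro hj
      obtain ⟨p, hp, hpf, hpη, hpP⟩ := ih (Nat.le_of_succ_le hj)
      obtain ⟨k, hkf, hkη⟩ := hfl j hj
      have hq := sup_mem_chainSet hp k
      obtain ⟨hpm, hp01⟩ := measurable_mem_Icc_of_mem_chainSet hl hp
      obtain ⟨hqm, hq01⟩ := measurable_mem_Icc_of_mem_chainSet hl hq
      have hqf : ∀ z, (p ⊔ l j k) z ≤ f z := fun z => sup_le (hpf z) (hkf z)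
      refine ⟨p ⊔ l j k, hq, hqf, fun a => ?_, ?_⟩
      · filter_upwards [ae_context_of_ae_refLaw hkη a] with w hw
        rw [hη j]
        exact (sub_le_sub_left le_sup_right _).trans hw
      · have h1 := hω j hj _ (sup_sub_mem_linkSet hp k)
        -- The link lies between `0` and both `f` and the gap `f - p`, so the constraint on `f`
        -- forces the variance condition of its deviation event; avoiding that event leaves only the
        -- bound on the process.
        have h2 : (n : ℝ)⁻¹ * ∑ i ∈ Finset.range n,
            isQuad (μ.map fun ω => (O 0 ω).1) (g i (history O i ω)) (p ⊔ l j k - p)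
              ≤ 2 * η j * v := by
          refine avg_isQuad_le hb hδ hγ hfm hf (fun z => sub_nonneg.2 le_sup_left) (fun z => ?_)
            (mul_nonneg two_pos.le (hη0 j)) (fun a => ?_) hfv
          · exact (sub_le_self _ (hp01 z).1).trans (hqf z)
          · filter_upwards [hpη a] with w hw
            exact (sub_le_sub_right (hqf _) _).trans hw
        have h3 : isProcess μ O g n (p ⊔ l j k - p) ω < √(2 * (2 * η j * v) * t j / n) :=
          not_le.1 fun h => h1 ⟨h2, h⟩
        rw [isProcess_sub hb hδ hγ hqm hq01 hpm hp01] at h3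
        rw [Finset.sum_range_succ]
        linarith
  obtain ⟨p, hp, hpf, hpη, hpP⟩ := hchain m le_rfl
  obtain ⟨hpm, hp01⟩ := measurable_mem_Icc_of_mem_chainSet hl hp
  have h1 : isProcess μ O g n (f - p) ω ≤ √(2 * η m * v) := by
    refine isProcess_le_sqrt hb hδ hγ hκ (hfm.sub hpm) (fun z => ⟨sub_nonneg.2 (hpf z),
      (sub_le_self _ (hp01 z).1).trans (hf z).2⟩) ?_
    exact avg_isQuad_le hb hδ hγ hfm hf (fun z => sub_nonneg.2 (hpf z))
      (fun z => sub_le_self _ (hp01 z).1) (mul_nonneg two_pos.le (hη0 m)) hpη hfv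
  rw [isProcess_sub hb hδ hγ hfm hf hpm hp01] at h1
  linarith

end Chaining

/-! ### Numerical constants and the choice of scales -/

/-- The sum of the deviation thresholds of the links is at most the entropy sum. -/
theorem sum_thresholds_le {a L : ℕ → ℝ} {r v x : ℝ} {n m : ℕ} (hr0 : 0 ≤ r) (hr : r ^ 2 = 1 / 2)
    (ha : ∀ j, a (j + 1) = r * a j) (ha0 : ∀ j, 0 ≤ a j) (ha1 : a 0 ≤ 1) (hL : ∀ j, 0 ≤ L j)
    (hv : 0 ≤ v) (hx : 0 ≤ x) :
    ∑ j ∈ Finset.range m,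
        √(2 * (2 * a j ^ 2 * v) * (x + 2 * ∑ i ∈ Finset.range (j + 1), L i) / n)
      ≤ 37 * √(v * x / n) + 127 * √(v / n) * ∑ j ∈ Finset.range m, (a j - a (j + 1)) * √(L j) := by
  have hr1 : r ≤ 5 / 7 := by nlinarith
  have hC : 0 < 1 - r := by linarith
  have hC' : (1 - r)⁻¹ ≤ 7 / 2 := by
    rw [inv_le_comm₀ hC (by norm_num)]; linarith
  have hC0 : 0 ≤ (1 - r)⁻¹ := inv_nonneg.2 hC.le
  -- Placing `x` at index `0` makes it part of every partial sum while it is counted only once after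
  -- summation by parts.
  set b : ℕ → ℝ := fun i => √(2 * L i + if i = 0 then x else 0) with hbdef
  have hb0 : ∀ i, 0 ≤ b i := fun i => Real.sqrt_nonneg _
  set w := √(v / n) with hw
  have hw0 : 0 ≤ w := Real.sqrt_nonneg _
  have hterm : ∀ j, √(2 * (2 * a j ^ 2 * v) * (x + 2 * ∑ i ∈ Finset.range (j + 1), L i) / n)
      ≤ 2 * w * (a j * ∑ i ∈ Finset.range (j + 1), b i) := fun j => by
    have h1 : x + 2 * ∑ i ∈ Finset.range (j + 1), L i
        = ∑ i ∈ Finset.range (j + 1), (2 * L i + if i = 0 then x else 0) := by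
      rw [Finset.sum_add_distrib, ← Finset.mul_sum, Finset.sum_ite_eq' (Finset.range (j + 1)) 0]
      simp [add_comm]
    have h2 : 2 * (2 * a j ^ 2 * v) * (x + 2 * ∑ i ∈ Finset.range (j + 1), L i) / n
        = (2 * a j) ^ 2 * (v / n * (x + 2 * ∑ i ∈ Finset.range (j + 1), L i)) := by ring
    rw [h2, Real.sqrt_mul (sq_nonneg _), Real.sqrt_sq (mul_nonneg two_pos.le (ha0 j)),
      Real.sqrt_mul (by positivity), ← hw, h1]
    have h3 := sqrt_sum_le_sum_sqrt (Finset.range (j + 1))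
      (f := fun i => 2 * L i + if i = 0 then x else 0) fun i => by
        have := hL i
        split_ifs <;> positivity
    calc _ ≤ 2 * a j * (w * ∑ i ∈ Finset.range (j + 1), b i) :=
          mul_le_mul_of_nonneg_left (mul_le_mul_of_nonneg_left h3 hw0)
            (mul_nonneg two_pos.le (ha0 j))
      _ = _ := by ring
  have hb : ∀ i, a i * b i ≤ 3 / 2 * (a i * √(L i)) + if i = 0 then √x else 0 := fun i => by
    have h1 : b i ≤ 3 / 2 * √(L i) + if i = 0 then √x else 0 := by
      have h2 : √(2 * L i) ≤ 3 / 2 * √(L i) := by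
        rw [Real.sqrt_mul two_pos.le]
        refine mul_le_mul_of_nonneg_right ?_ (Real.sqrt_nonneg _)
        rw [Real.sqrt_le_left (by norm_num)]; norm_num
      have h3 := sqrt_sum_le_sum_sqrt Finset.univ (f := ![2 * L i, if i = 0 then x else 0])
        fun k => by
          have := hL i
          fin_cases k
          · simpa using this
          · simp only [Fin.mk_one, Matrix.cons_val_one, Matrix.cons_val_fin_one]
            split_ifs <;> simp [hx]
      simp only [Fin.sum_univ_two, Matrix.cons_val_zero, Matrix.cons_val_one,
        Matrix.cons_val_fin_one] at h3
      have h4 : √(if i = 0 then x else 0) = if i = 0 then √x else 0 := by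
        split_ifs <;> simp
      rw [h4] at h3
      exact h3.trans (by linarith)
    calc a i * b i ≤ a i * (3 / 2 * √(L i) + if i = 0 then √x else 0) :=
          mul_le_mul_of_nonneg_left h1 (ha0 i)
      _ ≤ _ := by
          rw [mul_add]
          refine add_le_add (by linarith) ?_
          split_ifs with h
          · subst h; exact mul_le_of_le_one_left (Real.sqrt_nonneg _) ha1
          · simp
  have hsum : ∑ i ∈ Finset.range m, a i * b i
      ≤ 3 / 2 * ∑ i ∈ Finset.range m, a i * √(L i) + √x := by
    refine (Finset.sum_le_sum fun i _ => hb i).trans ?_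
    rw [Finset.sum_add_distrib, ← Finset.mul_sum, Finset.sum_ite_eq' (Finset.range m) 0]
    refine add_le_add le_rfl ?_
    split_ifs
    · exact le_rfl
    · exact Real.sqrt_nonneg _
  have hR : ∑ i ∈ Finset.range m, a i * √(L i)
      = (1 - r)⁻¹ * ∑ j ∈ Finset.range m, (a j - a (j + 1)) * √(L j) := by
    rw [Finset.mul_sum]
    refine Finset.sum_congr rfl fun j _ => ?_
    rw [ha]; field_simp
  set R := ∑ j ∈ Finset.range m, (a j - a (j + 1)) * √(L j) with hRdef
  have hR0 : 0 ≤ R := Finset.sum_nonneg fun j _ => mul_nonneg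
    (by rw [ha]; nlinarith [ha0 j]) (Real.sqrt_nonneg _)
  have hwx : w * √x = √(v * x / n) := by
    rw [hw, ← Real.sqrt_mul (by positivity)]; ring_nf
  calc _ ≤ ∑ j ∈ Finset.range m, 2 * w * (a j * ∑ i ∈ Finset.range (j + 1), b i) :=
        Finset.sum_le_sum fun j _ => hterm j
    _ ≤ 2 * w * ((1 - r)⁻¹ * ∑ i ∈ Finset.range m, a i * b i) := by
        rw [← Finset.mul_sum]
        exact mul_le_mul_of_nonneg_left
          (sum_geometric_mul_partial_sum_le (by linarith) ha ha0 hb0 m) (by positivity)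
    -- The two factors 7/2 bound 1/(1 - r): one from summation by parts, one from replacing `a j` by
    -- `a j - a (j + 1)`. The factor 3/2 bounds √2. The resulting coefficients 36.75 and 7 are below
    -- 127 and 37.
    _ ≤ 2 * w * (7 / 2 * (3 / 2 * (7 / 2 * R) + √x)) := by
        refine mul_le_mul_of_nonneg_left ?_ (by positivity)
        refine mul_le_mul hC' (hsum.trans ?_)
          (Finset.sum_nonneg fun i _ => mul_nonneg (ha0 i) (hb0 i)) (by norm_num)
        rw [hR]
        gcongr
    _ ≤ 37 * √(v * x / n) + 127 * w * R := by
        rw [← hwx]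
        nlinarith [mul_nonneg hw0 hR0, mul_nonneg hw0 (Real.sqrt_nonneg x)]

/-- The initial radius `c` is tuned so that halving lands exactly on ε/2, while `1 ≤ 2 * c` still
lets the chain start at `0`. -/
theorem exists_dyadic {ε : ℝ} (hε : ε ∈ Set.Ioc (0 : ℝ) 1) :
    ∃ (m : ℕ) (c : ℝ), 1 / 2 ≤ c ∧ c ≤ 1 ∧ c * (1 / 2) ^ m = ε / 2 := by
  obtain ⟨J, h1, h2⟩ := exists_nat_pow_near ((one_le_div hε.1).2 hε.2) one_lt_two
  rw [le_div_iff₀ hε.1] at h1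
  rw [div_lt_iff₀ hε.1, pow_succ] at h2
  refine ⟨J + 1, 2 ^ J * ε, by linarith, h1, ?_⟩
  rw [pow_succ, one_div, inv_pow]
  field_simp

/-! ### The maximal inequality -/

section MaximalInequality

variable {Ω : Type*} [MeasurableSpace Ω] {d K : ℕ} [NeZero K] {μ : Measure Ω}
  [IsProbabilityMeasure μ] {O : ℕ → Ω → Obs d K} {g : Designs d K} {δ : ℝ} {n : ℕ}
  {F : Set (Fin K × Context d → ℝ)}

/-- A single exceptional set, built from finitely many links and a null set, serves all of `F`; this
avoids any measurability question about the supremum. -/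
theorem exists_exceptional_set (hb : IsContextualBandit μ O g) (hF_meas : ∀ f ∈ F, Measurable f)
    (hF_range : ∀ f ∈ F, ∀ z, f z ∈ Set.Icc (0 : ℝ) 1) (hn : 1 ≤ n) (hδ : 0 < δ)
    (hg : ∀ᵐ ω ∂μ, ∀ i < n, ∀ a w, δ ≤ g i (history O i ω) (a, w))
    {x v ε : ℝ} (hx : 0 ≤ x) (hv : 0 < v) (hε : ε ∈ Set.Ioc (0 : ℝ) 1) :
    ∃ A : Set Ω, μ A ≤ ENNReal.ofReal (Real.exp (-x)) ∧ ∀ ω ∉ A, ∀ f ∈ F,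
      avgIsRatio μ O g n f ω ≤ v →
      ENNReal.ofReal (isProcess μ O g n f ω) ≤ ENNReal.ofReal (√(v * ε) + 37 * √(v * x / n))
        + ENNReal.ofReal (127 * √(v / n)) * ∫⁻ u in Set.Icc (√(ε / 2)) 1,
            logOneAdd (bracketingNumber (u ^ 2) F ∞ (refLaw μ O)) ^ (1 / 2 : ℝ) := by
  have hn0 : (0 : ℝ) < n := by exact_mod_cast hn
  obtain ⟨m, c, hc, hc1, hcm⟩ := exists_dyadic hε
  set r : ℝ := √(1 / 2) with hr
  have hr0 : 0 < r := Real.sqrt_pos.2 (by norm_num)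
  have hr2 : r ^ 2 = 1 / 2 := Real.sq_sqrt (by norm_num)
  have hr1 : r < 1 := by nlinarith
  set a : ℕ → ℝ := fun j => √c * r ^ j with ha
  have hc0 : 0 < c := by linarith
  have ha0 : ∀ j, 0 < a j := fun j => mul_pos (Real.sqrt_pos.2 hc0) (pow_pos hr0 j)
  have haS : ∀ j, a (j + 1) = r * a j := fun j => by simp only [ha, pow_succ]; ring
  have ha1 : a 0 ≤ 1 := by simpa [ha] using hc1
  have hasq : ∀ j, a j ^ 2 = c * (1 / 2) ^ j := fun j => by
    simp only [ha]
    rw [mul_pow, Real.sq_sqrt hc0.le, ← pow_mul, mul_comm j 2, pow_mul, hr2]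
  have hanti : Antitone a := antitone_nat_of_succ_le fun j => by
    rw [haS]; exact mul_le_of_le_one_left (ha0 j).le hr1.le
  have ham : a m = √(ε / 2) := by
    rw [← hcm, ← hasq, Real.sqrt_sq (ha0 m).le]
  set ν := refLaw μ O with hν
  have hint : ∑ j ∈ Finset.range m, ENNReal.ofReal (a j - a (j + 1))
        * logOneAdd (bracketingNumber (a j ^ 2) F ∞ ν) ^ (1 / 2 : ℝ)
      ≤ ∫⁻ u in Set.Icc (√(ε / 2)) 1,
          logOneAdd (bracketingNumber (u ^ 2) F ∞ ν) ^ (1 / 2 : ℝ) := by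
    refine (sum_le_lintegral_entropy F ν hanti (fun j => (ha0 j).le) ha1 m).trans ?_
    rw [ham]
    exact lintegral_mono_set Set.Ioc_subset_Icc_self
  have hw0 : 0 < 127 * √(v / n) := mul_pos (by norm_num) (Real.sqrt_pos.2 (by positivity))
  have hdiff : ∀ j, 0 < a j - a (j + 1) := fun j => by
    rw [haS]; nlinarith [ha0 j]
  -- An infinite bracketing number at a used radius makes the entropy integral infinite, and the
  -- claim is then void.
  by_cases hfin : ∀ j < m, bracketingNumber (a j ^ 2) F ∞ ν ≠ ⊤
  swap
  · push Not at hfin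
    obtain ⟨j, hj, hjt⟩ := hfin
    refine ⟨∅, by simp, fun ω _ f _ _ => ?_⟩
    have h1 : ∫⁻ u in Set.Icc (√(ε / 2)) 1,
        logOneAdd (bracketingNumber (u ^ 2) F ∞ ν) ^ (1 / 2 : ℝ) = ⊤ := by
      refine top_le_iff.1 (le_trans ?_ hint)
      refine le_trans ?_ (Finset.single_le_sum (fun _ _ => zero_le) (Finset.mem_range.2 hj))
      rw [hjt, logOneAdd_top, ENNReal.top_rpow_of_pos (by norm_num),
        ENNReal.mul_top (ENNReal.ofReal_pos.2 (hdiff j)).ne']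
    rw [h1, ENNReal.mul_top (ENNReal.ofReal_pos.2 hw0).ne']
    simp
  · set N : ℕ → ℕ := fun j => (bracketingNumber (a j ^ 2) F ∞ ν).toNat with hN
    have hNeq : ∀ j < m, bracketingNumber (a j ^ 2) F ∞ ν = N j := fun j hj =>
      (ENat.natCast_toNat (hfin j hj)).symm
    have hex : ∀ j, ∃ l : Fin (N j) → Fin K × Context d → ℝ,
        (∀ k, Measurable (l k) ∧ ∀ z, l k z ∈ Set.Icc (0 : ℝ) 1) ∧
        (j < m → ∀ f ∈ F, ∃ k, (∀ z, l k z ≤ f z) ∧ ∀ᵐ z ∂ν, f z - l k z ≤ a j ^ 2) := fun j => by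
      by_cases hj : j < m
      · obtain ⟨l, h1, h2⟩ := exists_lower_brackets hF_range (sq_nonneg (a j)) (hNeq j hj)
        exact ⟨l, h1, fun _ => h2⟩
      · exact ⟨fun _ _ => 0, fun _ => ⟨measurable_const, fun _ => by simp⟩, fun h => absurd h hj⟩
    choose l hl hlF using hex
    have hb0 : ∀ j, 0 < 2 * a j ^ 2 * v := fun j => by have := ha0 j; positivity
    have hA := measure_iUnion_linkEvent_le hb hδ hn hg hl hb0 hx m
    have hgood : ∀ᵐ ω ∂μ, (∀ i < n, ∀ a w, δ ≤ g i (history O i ω) (a, w)) ∧ ∀ i,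
        (condDistrib (O i) (history O i) μ (history O i ω)).map (fun o => (o.2.1, o.1))
          = designLaw (μ.map fun ω => (O 0 ω).1) (g i (history O i ω)) :=
      hg.and (ae_all_iff.2 fun i => hb.condDistrib_action_context i)
    refine ⟨_, (measure_union_le _ _).trans
      ((add_le_add (ae_iff.1 hgood).le hA).trans_eq (zero_add _)), fun ω hω f hf hfv => ?_⟩
    rw [Set.mem_union, not_or] at hω
    obtain ⟨hω1, hω2⟩ := hω
    obtain ⟨hγ, hκ⟩ := not_not.1 hω1
    have hlink : ∀ j < m, ∀ h ∈ linkSet l j, ω ∉ linkEvent μ O g n h (2 * a j ^ 2 * v)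
        (x + 2 * ∑ i ∈ Finset.range (j + 1), Real.log (1 + N i)) := fun j hj h hh hc =>
      hω2 (Set.mem_biUnion (Finset.mem_coe.2 (Finset.mem_range.2 hj))
        (Set.mem_biUnion (Finset.mem_coe.2 hh) hc))
    have hmain := isProcess_le_sum_links hb hδ hl (η := fun j => a j ^ 2)
      (fun j => sq_nonneg _) (by simp only [hasq]; linarith)
      (fun j => by simp only [hasq, pow_succ]; ring) hγ (fun i _ => hκ i) hlink
      (hF_meas f hf) (hF_range f hf) (fun j hj => hlF j hj f hf) hfv
    have hL : ∀ j, 0 ≤ Real.log (1 + N j) := fun j => Real.log_nonneg (by simp)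
    have hsum := sum_thresholds_le (n := n) (m := m) hr0.le hr2 haS (fun j => (ha0 j).le) ha1 hL
      hv.le hx
    have hR : ENNReal.ofReal (∑ j ∈ Finset.range m, (a j - a (j + 1)) * √(Real.log (1 + N j)))
        ≤ ∫⁻ u in Set.Icc (√(ε / 2)) 1,
            logOneAdd (bracketingNumber (u ^ 2) F ∞ ν) ^ (1 / 2 : ℝ) := by
      refine le_trans (le_of_eq ?_) hint
      rw [ENNReal.ofReal_sum_of_nonneg fun j _ => mul_nonneg (hdiff j).le (Real.sqrt_nonneg _)]
      refine Finset.sum_congr rfl fun j hj => ?_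
      rw [hNeq j (Finset.mem_range.1 hj), logOneAdd_natCast, ENNReal.ofReal_mul (hdiff j).le,
        ENNReal.ofReal_rpow_of_nonneg (hL j) (by norm_num), Real.sqrt_eq_rpow]
    have hfirst : 2 * a m ^ 2 * v = v * ε := by rw [hasq, hcm]; ring
    calc ENNReal.ofReal (isProcess μ O g n f ω)
        ≤ ENNReal.ofReal ((√(v * ε) + 37 * √(v * x / n)) + 127 * √(v / n)
            * ∑ j ∈ Finset.range m, (a j - a (j + 1)) * √(Real.log (1 + N j))) := by
          refine ENNReal.ofReal_le_ofReal ?_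
          rw [← hfirst]
          linarith
      _ = ENNReal.ofReal (√(v * ε) + 37 * √(v * x / n)) + ENNReal.ofReal (127 * √(v / n))
            * ENNReal.ofReal (∑ j ∈ Finset.range m, (a j - a (j + 1)) * √(Real.log (1 + N j))) := by
          rw [ENNReal.ofReal_add (by positivity), ENNReal.ofReal_mul hw0.le]
          exact mul_nonneg hw0.le (Finset.sum_nonneg fun j _ =>
            mul_nonneg (hdiff j).le (Real.sqrt_nonneg _))
      _ ≤ _ := by gcongr

/-- The compensator bound applied to `f` itself with radius 1. It keeps the supremum finite, which
disposes of an infinite threshold. -/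
theorem ae_isProcess_le_sqrt (hb : IsContextualBandit μ O g) (hF_meas : ∀ f ∈ F, Measurable f)
    (hF_range : ∀ f ∈ F, ∀ z, f z ∈ Set.Icc (0 : ℝ) 1) (hδ : 0 < δ)
    (hg : ∀ᵐ ω ∂μ, ∀ i < n, ∀ a w, δ ≤ g i (history O i ω) (a, w)) (v : ℝ) :
    ∀ᵐ ω ∂μ, ∀ f ∈ F, avgIsRatio μ O g n f ω ≤ v → isProcess μ O g n f ω ≤ √v := by
  filter_upwards [hg, ae_all_iff.2 fun i => hb.condDistrib_action_context i] with ω hγ hκ f hf hfv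
  refine isProcess_le_sqrt hb hδ hγ (fun i _ => hκ i) (hF_meas f hf) (hF_range f hf) ?_
  simpa using avg_isQuad_le hb hδ hγ (hF_meas f hf) (hF_range f hf) (fun z => (hF_range f hf z).1)
    (fun _ => le_rfl) zero_le_one
    (fun a => Filter.Eventually.of_forall fun w => (hF_range f hf (a, w)).2) hfv

end MaximalInequality

/-- At ε = 0 no finite chain reaches the required radius; a positive slack `s` pays for stopping at
some ε' > 0. -/
theorem exists_pos_sqrt_mul_lt {v ε s : ℝ} (hv : 0 < v) (hε : ε ∈ Set.Icc (0 : ℝ) 1) (hs : 0 < s) :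
    ∃ ε' ∈ Set.Ioc (0 : ℝ) 1, ε ≤ ε' ∧ √(v * ε') < √(v * ε) + s := by
  rcases hε.1.eq_or_lt with h0 | h0
  · refine ⟨min 1 ((s / 2) ^ 2 / v), ⟨lt_min one_pos (by positivity), min_le_left _ _⟩,
      h0 ▸ le_min zero_le_one (by positivity), ?_⟩
    rw [← h0, mul_zero, Real.sqrt_zero, zero_add]
    calc _ ≤ √((s / 2) ^ 2) := by
          refine Real.sqrt_le_sqrt ?_
          calc v * min 1 ((s / 2) ^ 2 / v) ≤ v * ((s / 2) ^ 2 / v) :=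
                mul_le_mul_of_nonneg_left (min_le_right _ _) hv.le
            _ = (s / 2) ^ 2 := by field_simp
      _ = s / 2 := Real.sqrt_sq (by positivity)
      _ < s := by linarith
  · exact ⟨ε, ⟨h0, hε.2⟩, le_rfl, by linarith⟩

/-- The maximal inequality with any threshold `H` that dominates the bias and the entropy integral;
no contribution of the entropy at radius `1` is needed. -/
theorem measure_sup_isProcess_ge_le {Ω : Type*} [MeasurableSpace Ω] {μ : Measure Ω}
    [IsProbabilityMeasure μ]
    {d K : ℕ} [NeZero K] {O : ℕ → Ω → Obs d K} {g : Designs d K}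
    (hbandit : IsContextualBandit μ O g)
    {F : Set (Fin K × Context d → ℝ)}
    (hF_meas : ∀ f ∈ F, Measurable f)
    (hF_range : ∀ f ∈ F, ∀ z, f z ∈ Set.Icc (0 : ℝ) 1)
    {n : ℕ} (hn : 1 ≤ n) {δ : ℝ} (hδ : 0 < δ)
    (hg : ∀ᵐ ω ∂μ, ∀ i < n, ∀ a w, δ ≤ g i (history O i ω) (a, w))
    {x v ε : ℝ} (hx : 0 < x) (hv : 0 < v) (hε : ε ∈ Set.Icc (0 : ℝ) 1) {H : ℝ≥0∞}
    (hH : ENNReal.ofReal √(v * ε) + ENNReal.ofReal (127 * √(v / n))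
      * (∫⁻ u in Set.Icc (√(ε / 2)) 1,
          logOneAdd (bracketingNumber (u ^ 2) F ∞ (refLaw μ O)) ^ (1 / 2 : ℝ)) ≤ H) :
    μ {ω | (H : EReal)
              + ((37 * √(v * x / n) + 3 * (x / (δ * n)) : ℝ) : EReal)
            ≤ ⨆ f ∈ F, ((Set.indicator {ω' | avgIsRatio μ O g n f ω' ≤ v}
                (isProcess μ O g n f) ω : ℝ) : EReal)}
      ≤ ENNReal.ofReal (2 * Real.exp (-x)) := by
  have hn0 : (0 : ℝ) < n := by exact_mod_cast hn
  have hs : 0 < 3 * (x / (δ * n)) := by positivity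
  obtain ⟨ε', hε', hεε', hlt⟩ := exists_pos_sqrt_mul_lt hv hε hs
  obtain ⟨A, hA, hAF⟩ :=
    exists_exceptional_set hbandit hF_meas hF_range hn hδ hg hx.le hv hε'
  have hB := ae_isProcess_le_sqrt hbandit hF_meas hF_range hδ hg v
  refine le_trans (measure_mono (t := {ω | ¬∀ f ∈ F, avgIsRatio μ O g n f ω ≤ v →
    isProcess μ O g n f ω ≤ √v} ∪ A) ?_) ((measure_union_le _ _).trans
      ((add_le_add (ae_iff.1 hB).le hA).trans ?_))
  swap
  · rw [zero_add]
    exact ENNReal.ofReal_le_ofReal (by linarith [Real.exp_pos (-x)])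
  intro ω hω
  by_contra hcon
  rw [Set.mem_union, not_or] at hcon
  obtain ⟨hω1, hω2⟩ := hcon
  have hω1 := not_not.1 hω1
  have hsup : ∀ M : ℝ, 0 ≤ M → (∀ f ∈ F, avgIsRatio μ O g n f ω ≤ v →
      isProcess μ O g n f ω ≤ M) → (H : EReal)
        + ((37 * √(v * x / n) + 3 * (x / (δ * n)) : ℝ) : EReal) ≤ (M : EReal) := fun M hM h => by
    refine le_trans hω (iSup₂_le fun f hf => EReal.coe_le_coe_iff.2 ?_)
    by_cases hfv : avgIsRatio μ O g n f ω ≤ v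
    · rw [Set.indicator_of_mem (show ω ∈ {ω' | avgIsRatio μ O g n f ω' ≤ v} from hfv)]
      exact h f hf hfv
    · rw [Set.indicator_of_notMem (show ω ∉ {ω' | avgIsRatio μ O g n f ω' ≤ v} from hfv)]
      exact hM
  set I := ENNReal.ofReal (127 * √(v / n)) * ∫⁻ u in Set.Icc (√(ε / 2)) 1,
    logOneAdd (bracketingNumber (u ^ 2) F ∞ (refLaw μ O)) ^ (1 / 2 : ℝ) with hI
  rcases eq_or_ne (H) ⊤ with htop | htop
  -- In `EReal` an infinite threshold could still be met by an infinite supremum; the bound √v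
  -- excludes this.
  · have h1 := hsup (√v) (Real.sqrt_nonneg _) hω1
    rw [htop, EReal.coe_ennreal_top, EReal.top_add_coe] at h1
    exact absurd h1 (not_le.2 (EReal.coe_lt_top _))
  have hItop : I ≠ ⊤ := fun h => htop (top_le_iff.1 (by simpa [h] using hH))
  have h1 := hsup (√(v * ε') + 37 * √(v * x / n) + I.toReal) (by positivity) fun f hf hfv => by
    have h2 := hAF ω hω2 f hf hfv
    have h3 : ENNReal.ofReal (isProcess μ O g n f ω)
        ≤ ENNReal.ofReal (√(v * ε') + 37 * √(v * x / n) + I.toReal) := by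
      rw [ENNReal.ofReal_add (by positivity) ENNReal.toReal_nonneg, ENNReal.ofReal_toReal hItop]
      refine h2.trans (add_le_add le_rfl (mul_le_mul_right (lintegral_mono_set ?_) _))
      exact Set.Icc_subset_Icc_left (Real.sqrt_le_sqrt (by linarith))
    exact (ENNReal.ofReal_le_ofReal_iff (by positivity)).1 h3
  have h4 : √(v * ε) + I.toReal ≤ H.toReal := by
    have h5 := ENNReal.toReal_mono htop hH
    rwa [ENNReal.toReal_add ENNReal.ofReal_ne_top hItop,
      ENNReal.toReal_ofReal (Real.sqrt_nonneg _)] at h5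
  rw [← EReal.coe_ennreal_toReal htop, ← EReal.coe_add, EReal.coe_le_coe_iff] at h1
  -- The strict inequality `hlt` contradicts `h1` and `h4`; strictness is needed because the event
  -- is defined by a non-strict inequality.
  linarith

theorem mainTheorem2 {Ω : Type*} [MeasurableSpace Ω] (μ : Measure Ω) [IsProbabilityMeasure μ]
    {d K : ℕ} [NeZero K] (O : ℕ → Ω → Obs d K) (g : Designs d K)
    (hbandit : IsContextualBandit μ O g)
    (F : Set (Fin K × Context d → ℝ))
    (hF_meas : ∀ f ∈ F, Measurable f)
    (hF_range : ∀ f ∈ F, ∀ z, f z ∈ Set.Icc (0 : ℝ) 1)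
    (n : ℕ) (hn : 1 ≤ n) (δ : ℝ) (hδ : 0 < δ)
    (hg : ∀ᵐ ω ∂μ, ∀ i < n, ∀ a w, δ ≤ g i (history O i ω) (a, w))
    (x v ε : ℝ) (hx : 0 < x) (hv : 0 < v) (hε : ε ∈ Set.Icc (0 : ℝ) 1) :
    μ {ω | (entropyTerm F (refLaw μ O) n v δ ε : EReal)
              + ((37 * √(v * x / n) + 3 * (x / (δ * n)) : ℝ) : EReal)
            ≤ ⨆ f ∈ F, ((Set.indicator {ω' | avgIsRatio μ O g n f ω' ≤ v}
                (isProcess μ O g n f) ω : ℝ) : EReal)}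
      ≤ ENNReal.ofReal (2 * Real.exp (-x)) := by
  refine measure_sup_isProcess_ge_le hbandit hF_meas hF_range hn hδ hg hx hv hε ?_
  exact add_le_add le_rfl (mul_le_mul_right (lintegral_mono fun u => le_add_right le_rfl) _)

end
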